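/- Let $R>0$, let $\theta\in[0,\pi)$ with $\theta\neq\pi/2$, and put $\kappa=\log 2-\gamma-\tan\theta$, where $\gamma$ is Euler's constant. Let $\Delta=-\frac{d^2}{dr^2}-\frac1{4r^2}$ on $[0,R]$, with maximal domain $\mathscr D_{\max}=\{\phi\in L^2([0,R]) : \Delta\phi\in L^2([0,R])\}$, where $\Delta\phi$ is understood in the sense of distributions on $(0,R)$. Every $\phi\in\mathscr D_{\max}$ can be written uniquely as $$\phi=c_1(\phi)\,r^{1/2}+c_2(\phi)\,r^{1/2}\log r+\widetilde\phi,$$ with constants $c_1(\phi),c_2(\phi)\in\mathbb C$ and $\widetilde\phi\in C^1([0,R])$ such that $\widetilde\phi=\mathcal O(r^{3/2})$ and $\widetilde\phi'=\mathcal O(r^{1/2})$ as $r\to0$. Let $\Delta_\theta$ be the restriction of $\Delta$ to the domain $$\mathscr D_\theta=\{\phi\in\mathscr D_{\max} : \cos\theta\,c_1(\phi)+\sin\theta\,c_2(\phi)=0,\ \phi(R)=0\}.$$ For $\mu\in\mathbb C\setminus\{0\}$ define $$F(\mu)=Y_0(\mu R)-\frac2\pi(\log\mu-\kappa)\,J_0(\mu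 R),$$ where $J_0,Y_0$ are the Bessel functions of order zero of the first and second kind and the logarithms (in $F$ and in $Y_0$) are principal. Then for every $\mu\in\mathbb C\setminus\{0\}$, the number $\mu^2$ belongs to the resolvent set of $\Delta_\theta$ if and only if $F(\mu)\neq0$. In that case $F$ is complex differentiable at $\mu$, the resolvent $(\Delta_\theta-\mu^2)^{-1}$ is a trace class operator on $L^2([0,R])$, and $$\operatorname{Tr}(\Delta_\theta-\mu^2)^{-1}=-\frac1{2\mu}\,\frac1{F(\mu)}\,\frac{d}{d\mu}F(\mu)=-\frac1{2\mu}\,\frac{d}{d\mu}\log F(\mu),$$ where $\log F$ is any continuous branch of the logarithm of $F$ near $\mu$; such branches exist and are differentiable at $\mu$. -/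

import Mathlib

open MeasureTheory Set Filter Topology Asymptotics
open scoped ContDiff ComplexConjugate

noncomputable section

/-! ## Bessel functions of order zero -/

/-- The Bessel function of the first kind `J₀`. -/
def besselJZero (z : ℂ) : ℂ :=
  ∑' k : ℕ, (-(z ^ 2) / 4) ^ k / ((k.factorial : ℂ) ^ 2)

/-- The Bessel function of the second kind `Y₀` (principal branch of the logarithm):
`(π/2) Y₀(z) = (log z - log 2 + γ) J₀(z) - ∑_{k ≥ 1} H_k (-z²/4)^k / (k!)²`.
The term `k = 0` of the series below vanishes since `H_0 = 0`. -/
def besselYZero (z : ℂ) : ℂ :=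
  (2 / (Real.pi : ℂ)) *
    ((Complex.log z - (Real.log 2 : ℂ) + (Real.eulerMascheroniConstant : ℂ)) * besselJZero z -
      ∑' k : ℕ, ((harmonic k : ℚ) : ℂ) * (-(z ^ 2) / 4) ^ k / ((k.factorial : ℂ) ^ 2))

/-- `κ = log 2 - γ - tan θ`. -/
def kappaConst (θ : ℝ) : ℝ :=
  Real.log 2 - Real.eulerMascheroniConstant - Real.tan θ

/-- `F(μ) = Y₀(μR) - (2/π) (log μ - κ) J₀(μR)`. -/
def charF (R θ : ℝ) (μ : ℂ) : ℂ :=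
  besselYZero (μ * R) -
    (2 / (Real.pi : ℂ)) * (Complex.log μ - (kappaConst θ : ℂ)) * besselJZero (μ * R)

/-! ## The maximal operator `Δ = -d²/dr² - 1/(4r²)` on `L²([0,R])` -/

/-- The Hilbert space `L²([0,R])` of complex-valued functions. -/
abbrev L2Interval (R : ℝ) : Type := Lp ℂ 2 (volume.restrict (Icc (0 : ℝ) R))

/-- The test functions `C_c^∞((0,R))`. -/
def IsTestFun (R : ℝ) (ξ : ℝ → ℂ) : Prop :=
  ContDiff ℝ ∞ ξ ∧ HasCompactSupport ξ ∧ tsupport ξ ⊆ Ioo 0 R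

/-- The differential expression `Δξ = -ξ'' - ξ/(4r²)` on smooth functions. -/
def deltaExpr (ξ : ℝ → ℂ) (r : ℝ) : ℂ :=
  -(deriv (deriv ξ) r) - ξ r / (4 * (r : ℂ) ^ 2)

/-- `Δφ = f` in the sense of distributions on `(0,R)`. -/
def IsWeakDelta (R : ℝ) (φ f : L2Interval R) : Prop :=
  ∀ ξ : ℝ → ℂ, IsTestFun R ξ →
    ∫ r in Icc (0 : ℝ) R, deltaExpr ξ r * conj (φ r) =
      ∫ r in Icc (0 : ℝ) R, ξ r * conj (f r)

theorem IsTestFun.memLp {R : ℝ} {ξ : ℝ → ℂ} (h : IsTestFun R ξ) :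
    MemLp ξ 2 (volume.restrict (Icc (0 : ℝ) R)) :=
  (h.1.continuous.memLp_of_hasCompactSupport h.2.1).restrict _

theorem IsTestFun.memLp_deltaExpr {R : ℝ} {ξ : ℝ → ℂ} (h : IsTestFun R ξ) :
    MemLp (deltaExpr ξ) 2 (volume.restrict (Icc (0 : ℝ) R)) := by
  obtain ⟨h1, h2, h3⟩ := h
  have hd1 : ContDiff ℝ ∞ (deriv ξ) := (contDiff_infty_iff_deriv.1 h1).2
  have hd2 : ContDiff ℝ ∞ (deriv (deriv ξ)) := (contDiff_infty_iff_deriv.1 hd1).2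
  have hq : Continuous fun r : ℝ => ξ r / (4 * (r : ℂ) ^ 2) := by
    rw [continuous_iff_continuousAt]
    intro r
    by_cases hr : r ∈ tsupport ξ
    · have hr0 : (r : ℂ) ≠ 0 := by exact_mod_cast (h3 hr).1.ne'
      refine h1.continuous.continuousAt.div (by fun_prop) ?_
      exact mul_ne_zero (by norm_num) (pow_ne_zero 2 hr0)
    · have h0 : ξ =ᶠ[𝓝 r] 0 := notMem_tsupport_iff_eventuallyEq.1 hr
      have h0' : (fun r : ℝ => ξ r / (4 * (r : ℂ) ^ 2)) =ᶠ[𝓝 r] fun _ => 0 := by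
        filter_upwards [h0] with x hx
        simp [hx]
      exact continuousAt_const.congr h0'.symm
  have hqs : HasCompactSupport fun r : ℝ => ξ r / (4 * (r : ℂ) ^ 2) := by
    refine h2.mono ?_
    intro r hr
    simp only [Function.mem_support] at hr ⊢
    intro h0
    simp [h0] at hr
  have hs : HasCompactSupport fun r : ℝ => -(deriv (deriv ξ) r) := by
    have := h2.deriv.deriv.comp_left (g := fun z : ℂ => -z) (by simp)
    exact this
  exact ((hd2.continuous.neg.memLp_of_hasCompactSupport hs).sub
    (hq.memLp_of_hasCompactSupport hqs)).restrict _

theorem integrable_mul_conj_of_memLp {R : ℝ} {g : ℝ → ℂ}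
    (hg : MemLp g 2 (volume.restrict (Icc (0 : ℝ) R))) (φ : L2Interval R) :
    Integrable (fun r => g r * conj (φ r)) (volume.restrict (Icc (0 : ℝ) R)) := by
  have h2 : MemLp (fun r => conj (φ r)) 2 (volume.restrict (Icc (0 : ℝ) R)) := (Lp.memLp φ).star
  exact hg.integrable_mul h2

/-- The graph of the maximal operator: all pairs `(φ, f)` in `L² × L²` with `Δφ = f` weakly. -/
def deltaMaxGraph (R : ℝ) : Submodule ℂ (L2Interval R × L2Interval R) where
  carrier := {p | IsWeakDelta R p.1 p.2}
  zero_mem' := by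
    intro ξ hξ
    have h0 : ((0 : L2Interval R) : ℝ → ℂ) =ᵐ[volume.restrict (Icc (0 : ℝ) R)] 0 :=
      Lp.coeFn_zero _ _ _
    have e1 : ∀ g : ℝ → ℂ,
        ∫ r in Icc (0 : ℝ) R, g r * conj ((0 : L2Interval R) r) = 0 := by
      intro g
      refine integral_eq_zero_of_ae ?_
      filter_upwards [h0] with r hr
      simp only [hr, Pi.zero_apply, map_zero, mul_zero]
    exact (e1 _).trans (e1 _).symm
  add_mem' := by
    intro p q hp hq ξ hξ
    have key : ∀ (g : ℝ → ℂ), MemLp g 2 (volume.restrict (Icc (0 : ℝ) R)) →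
        ∀ u v : L2Interval R, ∫ r in Icc (0 : ℝ) R, g r * conj ((u + v) r) =
          (∫ r in Icc (0 : ℝ) R, g r * conj (u r)) +
            ∫ r in Icc (0 : ℝ) R, g r * conj (v r) := by
      intro g hg u v
      rw [← integral_add (integrable_mul_conj_of_memLp hg u)
        (integrable_mul_conj_of_memLp hg v)]
      refine integral_congr_ae ?_
      filter_upwards [Lp.coeFn_add u v] with r hr
      rw [hr, Pi.add_apply, map_add, mul_add]
    have hp' := hp ξ hξ
    have hq' := hq ξ hξ
    simp only [Prod.fst_add, Prod.snd_add]
    rw [key _ hξ.memLp_deltaExpr, key _ hξ.memLp, hp', hq']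
  smul_mem' := by
    intro c p hp ξ hξ
    have key : ∀ (g : ℝ → ℂ) (u : L2Interval R),
        ∫ r in Icc (0 : ℝ) R, g r * conj ((c • u) r) =
          conj c * ∫ r in Icc (0 : ℝ) R, g r * conj (u r) := by
      intro g u
      rw [← integral_const_mul]
      refine integral_congr_ae ?_
      filter_upwards [Lp.coeFn_smul c u] with r hr
      rw [hr, Pi.smul_apply, smul_eq_mul, map_mul]
      ring
    have hp' := hp ξ hξ
    simp only [Prod.smul_fst, Prod.smul_snd]
    rw [key, key, hp']

/-- The distribution `Δφ` determines its representative in `L²`: the graph is single-valued. -/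
theorem deltaMaxGraph_single_valued (R : ℝ) (x : L2Interval R × L2Interval R)
    (hx : x ∈ deltaMaxGraph R) (hx0 : x.1 = 0) : x.2 = 0 := by
  obtain ⟨φ, f⟩ := x
  simp only at hx0 ⊢
  subst hx0
  have hz : IsWeakDelta R 0 f := hx
  have hint : ∀ g : ℝ → ℝ, ContDiff ℝ ∞ g → HasCompactSupport g → tsupport g ⊆ Ioo 0 R →
      ∫ r, g r • conj (f r) ∂(volume.restrict (Icc (0 : ℝ) R)) = 0 := by
    intro g hg1 hg2 hg3
    have hT : IsTestFun R fun r => (g r : ℂ) := by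
      refine ⟨Complex.ofRealCLM.contDiff.comp hg1, ?_, ?_⟩
      · exact hg2.comp_left (g := fun x : ℝ => (x : ℂ)) (by simp)
      · exact (tsupport_comp_subset (g := fun x : ℝ => (x : ℂ)) (by simp) g).trans hg3
    have h1 := hz _ hT
    have h0 : ((0 : L2Interval R) : ℝ → ℂ) =ᵐ[volume.restrict (Icc (0 : ℝ) R)] 0 :=
      Lp.coeFn_zero _ _ _
    have h2 : ∫ r in Icc (0 : ℝ) R, deltaExpr (fun r => (g r : ℂ)) r *
        conj ((0 : L2Interval R) r) = 0 := by
      refine integral_eq_zero_of_ae ?_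
      filter_upwards [h0] with r hr
      simp only [hr, Pi.zero_apply, map_zero, mul_zero]
    rw [h2] at h1
    simpa only [Complex.real_smul] using h1.symm
  have hfi : Integrable (fun r => conj (f r)) (volume.restrict (Icc (0 : ℝ) R)) :=
    ((Lp.memLp f).star).integrable (by norm_num)
  have hae := isOpen_Ioo.ae_eq_zero_of_integral_contDiff_smul_eq_zero
    (U := Ioo (0 : ℝ) R) (hfi.locallyIntegrable.locallyIntegrableOn _) hint
  refine (Lp.eq_zero_iff_ae_eq_zero).2 ?_
  have hmem : ∀ᵐ r ∂(volume.restrict (Icc (0 : ℝ) R)), r ∈ Ioo (0 : ℝ) R := by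
    rw [← restrict_Ioo_eq_restrict_Icc]
    exact ae_restrict_mem measurableSet_Ioo
  filter_upwards [hae, hmem] with r hr hr'
  simpa using hr hr'

/-- The maximal operator `Δ : D_max(Δ) → L²([0,R])`,
with `D_max(Δ) = {φ ∈ L² | Δφ ∈ L²}` in the distributional sense. -/
def deltaMax (R : ℝ) : L2Interval R →ₗ.[ℂ] L2Interval R :=
  (deltaMaxGraph R).toLinearPMap

theorem deltaMax_graph (R : ℝ) : (deltaMax R).graph = deltaMaxGraph R :=
  Submodule.toLinearPMap_graph_eq _ (deltaMaxGraph_single_valued R)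

/-! ## Boundary data and the realization `Δ_θ` -/

/-- `φ = c₁ r^{1/2} + c₂ r^{1/2} log r + φ̃` on `[0,R]`, with `φ̃` continuously differentiable on
`[0,R]`, `φ̃ = O(r^{3/2})` and `φ̃' = O(r^{1/2})` as `r → 0`; `b` is the boundary value `φ(R)`.
For `φ` in the maximal domain, `Δφ̃ = Δφ` is automatically in `L²`, because `r^{1/2}` and
`r^{1/2} log r` are annihilated by `Δ`. -/
def HasBoundaryData (R : ℝ) (φ : L2Interval R) (c₁ c₂ b : ℂ) : Prop :=
  ∃ ψ : ℝ → ℂ,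
    ContDiffOn ℝ 1 ψ (Icc 0 R) ∧
    (ψ =O[𝓝[>] (0 : ℝ)] fun r : ℝ => r ^ (3 / 2 : ℝ)) ∧
    (derivWithin ψ (Icc 0 R) =O[𝓝[>] (0 : ℝ)] fun r : ℝ => r ^ (1 / 2 : ℝ)) ∧
    (∀ᵐ r ∂(volume.restrict (Icc (0 : ℝ) R)),
      φ r = c₁ * (√r : ℝ) + c₂ * (√r * Real.log r : ℝ) + ψ r) ∧
    b = c₁ * (√R : ℝ) + c₂ * (√R * Real.log R : ℝ) + ψ R

theorem HasBoundaryData.zero (R : ℝ) : HasBoundaryData R 0 0 0 0 := by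
  refine ⟨fun _ => 0, contDiffOn_const, isBigO_zero _ _, ?_, ?_, by simp⟩
  · have : derivWithin (fun _ : ℝ => (0 : ℂ)) (Icc 0 R) = fun _ => 0 := by
      funext r
      simp
    rw [this]
    exact isBigO_zero _ _
  · filter_upwards [Lp.coeFn_zero ℂ 2 (volume.restrict (Icc (0 : ℝ) R))] with r hr
    rw [hr]
    simp

theorem HasBoundaryData.add {R : ℝ} (hR : 0 < R) {φ φ' : L2Interval R}
    {c₁ c₂ b c₁' c₂' b' : ℂ} (h : HasBoundaryData R φ c₁ c₂ b)
    (h' : HasBoundaryData R φ' c₁' c₂' b') :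
    HasBoundaryData R (φ + φ') (c₁ + c₁') (c₂ + c₂') (b + b') := by
  obtain ⟨ψ, h1, h2, h3, h4, h5⟩ := h
  obtain ⟨ψ', h1', h2', h3', h4', h5'⟩ := h'
  refine ⟨fun r => ψ r + ψ' r, h1.add h1', h2.add h2', ?_, ?_, ?_⟩
  · refine (h3.add h3').congr' ?_ EventuallyEq.rfl
    filter_upwards [Ioo_mem_nhdsGT hR] with r hr
    have hr' : r ∈ Icc 0 R := ⟨hr.1.le, hr.2.le⟩
    exact (derivWithin_fun_add (h1.differentiableOn (by norm_num) r hr')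
      (h1'.differentiableOn (by norm_num) r hr')).symm
  · filter_upwards [h4, h4', Lp.coeFn_add φ φ'] with r hr hr' hs
    rw [hs, Pi.add_apply, hr, hr']
    ring
  · rw [h5, h5']
    ring

theorem HasBoundaryData.smul {R : ℝ} (c : ℂ) {φ : L2Interval R}
    {c₁ c₂ b : ℂ} (h : HasBoundaryData R φ c₁ c₂ b) :
    HasBoundaryData R (c • φ) (c * c₁) (c * c₂) (c * b) := by
  obtain ⟨ψ, h1, h2, h3, h4, h5⟩ := h
  refine ⟨fun r => c * ψ r, contDiffOn_const.mul h1, h2.const_mul_left c, ?_, ?_, ?_⟩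
  · have : derivWithin (fun r => c * ψ r) (Icc 0 R) =
        fun r => c * derivWithin ψ (Icc 0 R) r := by
      funext r
      exact derivWithin_const_mul_field c
    rw [this]
    exact h3.const_mul_left c
  · filter_upwards [h4, Lp.coeFn_smul c φ] with r hr hs
    rw [hs, Pi.smul_apply, hr, smul_eq_mul]
    ring
  · rw [h5]
    ring

/-- The boundary conditions `cos θ c₁(φ) + sin θ c₂(φ) = 0` and `φ(R) = 0`. -/
def boundarySpace (R : ℝ) (hR : 0 < R) (θ : ℝ) : Submodule ℂ (L2Interval R) where
  carrier := {φ | ∃ c₁ c₂ : ℂ, HasBoundaryData R φ c₁ c₂ 0 ∧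
    (Real.cos θ : ℂ) * c₁ + (Real.sin θ : ℂ) * c₂ = 0}
  zero_mem' := ⟨0, 0, HasBoundaryData.zero R, by simp⟩
  add_mem' := by
    rintro φ φ' ⟨c₁, c₂, h, hc⟩ ⟨c₁', c₂', h', hc'⟩
    refine ⟨c₁ + c₁', c₂ + c₂', by simpa using h.add hR h', ?_⟩
    linear_combination hc + hc'
  smul_mem' := by
    rintro c φ ⟨c₁, c₂, h, hc⟩
    refine ⟨c * c₁, c * c₂, by simpa using h.smul c, ?_⟩
    linear_combination c * hc

/-- The realization `Δ_θ`: the restriction of the maximal operator to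
`D_θ = {φ ∈ D_max(Δ) | cos θ c₁(φ) + sin θ c₂(φ) = 0, φ(R) = 0}`. -/
def deltaTheta (R : ℝ) (hR : 0 < R) (θ : ℝ) : L2Interval R →ₗ.[ℂ] L2Interval R :=
  (deltaMax R).domRestrict (boundarySpace R hR θ)

/-! ## Resolvents and traces -/

section Hilbert

variable {H : Type} [NormedAddCommGroup H] [InnerProductSpace ℂ H]

/-- The bounded operator `S` is the resolvent `(A - z)⁻¹` of the unbounded operator `A`. -/
def IsResolventAt (A : H →ₗ.[ℂ] H) (z : ℂ) (S : H →L[ℂ] H) : Prop :=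
  (∀ x : A.domain, S (A x - z • (x : H)) = x) ∧
    ∀ y : H, ∃ x : A.domain, (x : H) = S y ∧ A x - z • (x : H) = y

/-- The resolvent set of the unbounded operator `A`. -/
def unboundedResolventSet (A : H →ₗ.[ℂ] H) : Set ℂ :=
  {z | ∃ S : H →L[ℂ] H, IsResolventAt A z S}

/-- Trace class (nuclear) operators on a Hilbert space:
`T = ∑ₙ ⟨xₙ, ·⟩ yₙ` with `∑ₙ ‖xₙ‖ ‖yₙ‖ < ∞`. -/
def IsTraceClass (T : H →L[ℂ] H) : Prop :=
  ∃ x y : ℕ → H, Summable (fun n => ‖x n‖ * ‖y n‖) ∧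
    ∀ v : H, HasSum (fun n => inner ℂ (x n) v • y n) (T v)

/-- `T` is trace class and `Tr T = t`: `∑ᵢ ⟨eᵢ, T eᵢ⟩ = t` for every orthonormal basis. -/
def HasTrace (T : H →L[ℂ] H) (t : ℂ) : Prop :=
  IsTraceClass T ∧ ∀ (ι : Type) (e : HilbertBasis ι ℂ H),
    HasSum (fun i => inner ℂ (e i) (T (e i))) t

end Hilbert

end

/-!
Write `r^{1/2} (log r - a)`, `a = tan θ`, for the zero-energy solution satisfying the boundary
condition of `Δ_θ` at `0`. Variation of constants gives a right inverse `V` of `Δ` with vanishing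
data at `0`. It is a product of two Hilbert-Schmidt Volterra operators, so `1 - zV` is invertible
for every `z`, and `V (1 - zV)⁻¹` is trace class with trace `0`: multiplying out the two kernels,
the diagonal of the product vanishes by causality.

Hence `u_z = (1 - zV)⁻¹ (r^{1/2} (log r - a))` spans the solutions of `Δu = zu` obeying the
condition at `0`, and `z` lies in the resolvent set of `Δ_θ` if and only if `D(z) = u_z(R) ≠ 0`.
The resolvent is then `V (1 - zV)⁻¹` plus the rank one operator `f ↦ -D(z)⁻¹ ℓ((1 - zV)⁻¹ f) u_z`,
where `ℓ(g) = (V g)(R)`. Its trace is `-D(z)⁻¹ ℓ((1 - zV)⁻¹ u_z) = -D'(z) / D(z)`.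

The powers of `V` applied to `r^{1/2} (log r - a)` are explicit, and summing the Neumann series
identifies `D(μ²)` with a nonzero constant multiple of `F(μ)`. The chain rule for `μ ↦ μ²` produces
the factor `1 / (2μ)`.
-/

section Trace

variable {H K : Type} [NormedAddCommGroup H] [InnerProductSpace ℂ H]
  [NormedAddCommGroup K] [InnerProductSpace ℂ K]

theorem isTraceClass_of_countable {ι : Type*} [Countable ι] {T : H →L[ℂ] H} (x y : ι → H)
    (hs : Summable fun i => ‖x i‖ * ‖y i‖)
    (hT : ∀ v : H, HasSum (fun i => inner ℂ (x i) v • y i) (T v)) : IsTraceClass T := by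
  obtain ⟨f, hf⟩ := exists_injective_nat ι
  have extend_map : ∀ {E : Type _} [AddCommMonoid E] (g : H → H → E), g 0 0 = 0 →
      (fun n => g (Function.extend f x 0 n) (Function.extend f y 0 n)) =
        Function.extend f (fun i => g (x i) (y i)) 0 := by
    intro E _ g hg
    funext n
    by_cases hn : ∃ i, f i = n
    · obtain ⟨i, rfl⟩ := hn
      simp only [hf.extend_apply]
    · simp only [Function.extend_apply' _ _ _ hn, Pi.zero_apply, hg]
  refine ⟨Function.extend f x 0, Function.extend f y 0, ?_, fun v => ?_⟩
  · rw [extend_map (fun a b => ‖a‖ * ‖b‖) (by simp)]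
    exact ((hasSum_extend_zero hf).2 hs.hasSum).summable
  · rw [extend_map (fun a b => inner ℂ a v • b) (by simp)]
    exact (hasSum_extend_zero hf).2 (hT v)

theorem IsTraceClass.add {S T : H →L[ℂ] H} (hS : IsTraceClass S) (hT : IsTraceClass T) :
    IsTraceClass (S + T) := by
  obtain ⟨x, y, hxy, hS⟩ := hS
  obtain ⟨x', y', hxy', hT⟩ := hT
  refine isTraceClass_of_countable (ι := ℕ ⊕ ℕ) (Sum.elim x x') (Sum.elim y y') ?_ fun v => ?_
  · exact (HasSum.sum (by simpa [Function.comp_def] using hxy.hasSum)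
      (by simpa [Function.comp_def] using hxy'.hasSum)).summable
  · exact HasSum.sum (by simpa [Function.comp_def] using hS v)
      (by simpa [Function.comp_def] using hT v)

theorem HasTrace.add {S T : H →L[ℂ] H} {s t : ℂ} (hS : HasTrace S s) (hT : HasTrace T t) :
    HasTrace (S + T) (s + t) := by
  refine ⟨hS.1.add hT.1, fun ι e => ?_⟩
  simpa [inner_add_right] using (hS.2 ι e).add (hT.2 ι e)

theorem hasTrace_smulRight [CompleteSpace H] (φ : H →L[ℂ] ℂ) (y : H) :
    HasTrace (φ.smulRight y) (φ y) := by
  obtain ⟨x, rfl⟩ := (InnerProductSpace.toDual ℂ H).surjective φ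
  refine ⟨isTraceClass_of_countable (ι := Unit) (fun _ => x) (fun _ => y)
    (hasSum_fintype _).summable fun v => by simp, fun ι e => ?_⟩
  simpa [inner_smul_right] using e.hasSum_inner_mul_inner x y

theorem sum_norm_inner_mul_norm_inner_le {ι : Type*} {e : ι → H}
    (he : Orthonormal ℂ e) (x y : H) (s : Finset ι) :
    ∑ i ∈ s, ‖inner ℂ x (e i)‖ * ‖inner ℂ (e i) y‖ ≤ ‖x‖ * ‖y‖ := by
  have hx : ∑ i ∈ s, ‖inner ℂ x (e i)‖ ^ 2 ≤ ‖x‖ ^ 2 := by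
    simpa only [norm_inner_symm x] using he.sum_inner_products_le x (s := s)
  have hy : ∑ i ∈ s, ‖inner ℂ (e i) y‖ ^ 2 ≤ ‖y‖ ^ 2 := he.sum_inner_products_le y
  refine (Real.sum_mul_le_sqrt_mul_sqrt s _ _).trans ?_
  exact mul_le_mul ((Real.sqrt_le_left (norm_nonneg _)).2 hx)
    ((Real.sqrt_le_left (norm_nonneg _)).2 hy) (Real.sqrt_nonneg _) (norm_nonneg _)

theorem hasTrace_of_nuclear {T : H →L[ℂ] H} (x y : ℕ → H)
    (hs : Summable fun n => ‖x n‖ * ‖y n‖)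
    (hT : ∀ v : H, HasSum (fun n => inner ℂ (x n) v • y n) (T v)) :
    HasTrace T (∑' n, inner ℂ (x n) (y n)) := by
  refine ⟨⟨x, y, hs, hT⟩, fun ι e => ?_⟩
  let g : ℕ × ι → ℂ := fun p => inner ℂ (x p.1) (e p.2) * inner ℂ (e p.2) (y p.1)
  have hrow : ∀ n (s : Finset ι), ∑ i ∈ s, ‖g (n, i)‖ ≤ ‖x n‖ * ‖y n‖ := fun n s => by
    simpa [g] using sum_norm_inner_mul_norm_inner_le e.orthonormal (x n) (y n) s
  have hg : Summable g := by
    refine .of_norm ((summable_prod_of_nonneg fun _ => norm_nonneg _).2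
      ⟨fun n => summable_of_sum_le (fun _ => norm_nonneg _) (hrow n), ?_⟩)
    exact hs.of_nonneg_of_le (fun n => tsum_nonneg fun _ => norm_nonneg _)
      fun n => Real.tsum_le_of_sum_le (fun _ => norm_nonneg _) (hrow n)
  have hrows : HasSum (fun n => inner ℂ (x n) (y n)) (∑' p, g p) :=
    hg.hasSum.prod_fiberwise fun n => e.hasSum_inner_mul_inner (x n) (y n)
  rw [hrows.tsum_eq]
  refine ((Equiv.prodComm ι ℕ).hasSum_iff.2 hg.hasSum).prod_fiberwise fun i => ?_
  simpa [g, inner_smul_right, Function.comp_def] using (hT (e i)).mapL (innerSL ℂ (e i))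

theorem IsTraceClass.hasTrace_of_hasSum {T : H →L[ℂ] H} (hT : IsTraceClass T) {ι : Type}
    (e : HilbertBasis ι ℂ H) {t : ℂ} (ht : HasSum (fun i => inner ℂ (e i) (T (e i))) t) :
    HasTrace T t := by
  obtain ⟨x, y, hs, h⟩ := hT
  have hT' := hasTrace_of_nuclear x y hs h
  rwa [(hT'.2 ι e).unique ht] at hT'

theorem countable_of_orthonormal [SecondCountableTopology H] {ι : Type*} {e : ι → H}
    (he : Orthonormal ℂ e) : Countable ι := by
  have hdisj : Pairwise fun i j =>
      Disjoint (Metric.ball (e i) (1 / 2)) (Metric.ball (e j) (1 / 2)) := by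
    intro i j hij
    refine Metric.ball_disjoint_ball ?_
    have hsq : ‖e i - e j‖ ^ 2 = 2 := by
      have h := norm_sub_sq (𝕜 := ℂ) (e i) (e j)
      rw [he.2 hij, he.1, he.1] at h
      norm_num at h
      exact h
    rw [dist_eq_norm]
    nlinarith [norm_nonneg (e i - e j)]
  exact countable_univ_iff.1 <| PairwiseDisjoint.countable_of_isOpen
    (s := fun i => Metric.ball (e i) (1 / 2)) (fun i _ j _ hij => hdisj hij)
    (fun _ _ => Metric.isOpen_ball) fun i _ => ⟨e i, Metric.mem_ball_self (by norm_num)⟩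

theorem hasSum_norm_inner_sq {ι : Type*} (e : HilbertBasis ι ℂ H) (x : H) :
    HasSum (fun i => ‖inner ℂ (e i) x‖ ^ 2) (‖x‖ ^ 2) := by
  have h := e.hasSum_inner_mul_inner x x
  have hterm : ∀ i, inner ℂ x (e i) * inner ℂ (e i) x = ((‖inner ℂ (e i) x‖ ^ 2 : ℝ) : ℂ) :=
    fun i => by rw [← inner_conj_symm, Complex.conj_mul', Complex.ofReal_pow]
  simp only [hterm, inner_self_eq_norm_sq_to_K] at h
  exact Complex.hasSum_ofReal.1 (by simpa using h)

theorem summable_norm_sq_adjoint [CompleteSpace H] [CompleteSpace K] {ι κ : Type*}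
    (e : HilbertBasis ι ℂ H) {f : κ → K} (hf : Orthonormal ℂ f) {T : H →L[ℂ] K}
    (hT : Summable fun i => ‖T (e i)‖ ^ 2) : Summable fun j => ‖T.adjoint (f j)‖ ^ 2 := by
  refine summable_of_sum_le (c := ∑' i, ‖T (e i)‖ ^ 2) (fun _ => sq_nonneg _) fun s => ?_
  have hsum : HasSum (fun i => ∑ j ∈ s, ‖inner ℂ (f j) (T (e i))‖ ^ 2)
      (∑ j ∈ s, ‖T.adjoint (f j)‖ ^ 2) := by
    refine hasSum_sum fun j _ => ?_
    simpa only [ContinuousLinearMap.adjoint_inner_right, norm_inner_symm (f j)]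
      using hasSum_norm_inner_sq e (T.adjoint (f j))
  exact hasSum_le (fun i => hf.sum_inner_products_le (T (e i))) hsum hT.hasSum

theorem isTraceClass_adjoint_comp [CompleteSpace H] [CompleteSpace K] {ι κ : Type*} [Countable κ]
    (e : HilbertBasis ι ℂ H) (f : HilbertBasis κ ℂ K) {S T : H →L[ℂ] K}
    (hS : Summable fun i => ‖S (e i)‖ ^ 2) (hT : Summable fun i => ‖T (e i)‖ ^ 2) :
    IsTraceClass (S.adjoint ∘L T) := by
  refine isTraceClass_of_countable (fun j => T.adjoint (f j)) (fun j => S.adjoint (f j)) ?_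
    fun v => ?_
  · refine ((summable_norm_sq_adjoint e f.orthonormal hT).add
      (summable_norm_sq_adjoint e f.orthonormal hS)).of_nonneg_of_le
        (fun _ => by positivity) fun j => ?_
    nlinarith [sq_nonneg (‖T.adjoint (f j)‖ - ‖S.adjoint (f j)‖),
      sq_nonneg ‖T.adjoint (f j)‖, sq_nonneg ‖S.adjoint (f j)‖]
  · simpa [ContinuousLinearMap.adjoint_inner_left, f.repr_apply_apply] using
      (f.hasSum_repr (T v)).mapL S.adjoint

end Trace

section Carleman

variable {X : Type} [MeasurableSpace X] {ν : Measure X}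
  {H H' : Type} [NormedAddCommGroup H] [InnerProductSpace ℂ H]
  [NormedAddCommGroup H'] [InnerProductSpace ℂ H']

theorem norm_sq_eq_integral (f : Lp ℂ 2 ν) : ‖f‖ ^ 2 = ∫ x, ‖f x‖ ^ 2 ∂ν := by
  have h : ((‖f‖ ^ 2 : ℝ) : ℂ) = ∫ x, ((‖f x‖ ^ 2 : ℝ) : ℂ) ∂ν := by
    have hinner := L2.inner_def (𝕜 := ℂ) f f
    simp only [inner_self_eq_norm_sq_to_K, Complex.coe_algebraMap] at hinner
    exact_mod_cast hinner
  rwa [integral_complex_ofReal, Complex.ofReal_inj] at h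

theorem norm_sq_toLp {f : X → ℂ} (hf : MemLp f 2 ν) : ‖hf.toLp‖ ^ 2 = ∫ x, ‖f x‖ ^ 2 ∂ν := by
  rw [norm_sq_eq_integral]
  refine integral_congr_ae ?_
  filter_upwards [hf.coeFn_toLp] with x hx
  rw [hx]

theorem norm_integral_mul_le {a : X → ℂ} (ha : MemLp a 2 ν) (f : Lp ℂ 2 ν) :
    ‖∫ x, a x * f x ∂ν‖ ≤ √(∫ x, ‖a x‖ ^ 2 ∂ν) * ‖f‖ := by
  have hinner : inner ℂ ha.star.toLp f = ∫ x, a x * f x ∂ν := by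
    rw [L2.inner_def]
    refine integral_congr_ae ?_
    filter_upwards [ha.star.coeFn_toLp] with x hx
    rw [hx, RCLike.inner_apply, Pi.star_apply, RCLike.star_def, RCLike.conj_conj, mul_comm]
  have hnorm : ‖ha.star.toLp‖ = √(∫ x, ‖a x‖ ^ 2 ∂ν) := by
    rw [← Real.sqrt_sq (norm_nonneg ha.star.toLp), norm_sq_toLp]
    simp only [Pi.star_apply, norm_star]
  exact hinner ▸ hnorm ▸ norm_inner_le_norm _ _

/-- `T` is the Carleman operator `(T f)(x) = ⟨k x, f⟩` with a bounded field of representers `k`. -/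
def IsCarleman (T : H →L[ℂ] Lp ℂ 2 ν) (k : X → H) : Prop :=
  (∃ C, ∀ x, ‖k x‖ ≤ C) ∧ ∀ f : H, T f =ᵐ[ν] fun x => inner ℂ (k x) f

theorem IsCarleman.comp [CompleteSpace H] [CompleteSpace H'] {T : H →L[ℂ] Lp ℂ 2 ν} {k : X → H}
    (hT : IsCarleman T k) (D : H' →L[ℂ] H) : IsCarleman (T ∘L D) fun x => D.adjoint (k x) := by
  obtain ⟨⟨C, hC⟩, hT⟩ := hT
  exact ⟨⟨‖D.adjoint‖ * C, fun x => D.adjoint.le_opNorm_of_le (hC x)⟩, fun f => by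
    simpa [ContinuousLinearMap.adjoint_inner_left] using hT (D f)⟩

theorem IsCarleman.summable_norm_sq [IsFiniteMeasure ν] {T : H →L[ℂ] Lp ℂ 2 ν} {k : X → H}
    (hT : IsCarleman T k) {ι : Type*} {e : ι → H} (he : Orthonormal ℂ e) :
    Summable fun i => ‖T (e i)‖ ^ 2 := by
  obtain ⟨⟨C, hC⟩, hT⟩ := hT
  refine summable_of_sum_le (c := ∫ _, C ^ 2 ∂ν) (fun _ => sq_nonneg _) fun s => ?_
  have hint : ∀ i, Integrable (fun x => ‖T (e i) x‖ ^ 2) ν := fun i =>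
    (Lp.memLp (T (e i))).integrable_norm_pow (by norm_num)
  simp only [norm_sq_eq_integral]
  rw [← integral_finsetSum _ fun i _ => hint i]
  refine integral_mono_ae (integrable_finsetSum _ fun i _ => hint i) (integrable_const _) ?_
  have hall : ∀ᵐ x ∂ν, ∀ i ∈ s, T (e i) x = inner ℂ (k x) (e i) :=
    (ae_ball_iff s.countable_toSet).2 fun i _ => hT (e i)
  filter_upwards [hall] with x hx
  calc ∑ i ∈ s, ‖T (e i) x‖ ^ 2 = ∑ i ∈ s, ‖inner ℂ (e i) (k x)‖ ^ 2 :=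
        Finset.sum_congr rfl fun i hi => by rw [hx i hi, norm_inner_symm]
    _ ≤ ‖k x‖ ^ 2 := he.sum_inner_products_le _
    _ ≤ C ^ 2 := pow_le_pow_left₀ (norm_nonneg _) (hC x) 2

theorem IsCarleman.hasSum_inner [IsFiniteMeasure ν] {S T : H →L[ℂ] Lp ℂ 2 ν} {k l : X → H}
    (hS : IsCarleman S k) (hT : IsCarleman T l) {ι : Type*} [Countable ι]
    (e : HilbertBasis ι ℂ H) :
    HasSum (fun i => inner ℂ (S (e i)) (T (e i))) (∫ x, inner ℂ (l x) (k x) ∂ν) := by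
  obtain ⟨⟨C, hC⟩, hS⟩ := hS
  obtain ⟨⟨C', hC'⟩, hT⟩ := hT
  have hterm : ∀ᵐ x ∂ν, ∀ i, inner ℂ (S (e i) x) (T (e i) x) =
      inner ℂ (l x) (e i) * inner ℂ (e i) (k x) := by
    filter_upwards [ae_all_iff.2 fun i => hS (e i), ae_all_iff.2 fun i => hT (e i)] with x hk hl i
    rw [hk i, hl i, RCLike.inner_apply, inner_conj_symm]
  have hint : ∀ s : Finset ι, Integrable (fun x => ∑ i ∈ s, inner ℂ (S (e i) x) (T (e i) x)) ν :=
    fun s => integrable_finsetSum s fun i _ => L2.integrable_inner (S (e i)) (T (e i))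
  have hbound : ∀ s : Finset ι, ∀ᵐ x ∂ν, ‖∑ i ∈ s, inner ℂ (S (e i) x) (T (e i) x)‖ ≤ C' * C := by
    intro s
    filter_upwards [hterm] with x hx
    simp only [hx]
    refine (norm_sum_le _ _).trans ?_
    simp only [norm_mul]
    refine (sum_norm_inner_mul_norm_inner_le e.orthonormal _ _ s).trans ?_
    exact mul_le_mul (hC' x) (hC x) (norm_nonneg _) ((norm_nonneg _).trans (hC' x))
  have hlim : ∀ᵐ x ∂ν, Tendsto (fun s : Finset ι => ∑ i ∈ s, inner ℂ (S (e i) x) (T (e i) x))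
      atTop (𝓝 (inner ℂ (l x) (k x))) := by
    filter_upwards [hterm] with x hx
    simp only [hx]
    exact e.hasSum_inner_mul_inner (l x) (k x)
  refine (tendsto_integral_filter_of_dominated_convergence (fun _ => C' * C)
    (.of_forall fun s => (hint s).aestronglyMeasurable) (.of_forall hbound)
    (integrable_const _) hlim).congr fun s => ?_
  rw [integral_finsetSum _ fun i _ => L2.integrable_inner (S (e i)) (T (e i))]
  rfl

theorem IsCarleman.hasTrace_adjoint_comp [IsFiniteMeasure ν] [CompleteSpace H]
    [SecondCountableTopology H] [SecondCountableTopology (Lp ℂ 2 ν)]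
    {S T : H →L[ℂ] Lp ℂ 2 ν} {k l : X → H} (hS : IsCarleman S k) (hT : IsCarleman T l) :
    HasTrace (S.adjoint ∘L T) (∫ x, inner ℂ (l x) (k x) ∂ν) := by
  obtain ⟨ι, e, -⟩ := exists_hilbertBasis ℂ H
  obtain ⟨κ, f, -⟩ := exists_hilbertBasis ℂ (Lp ℂ 2 ν)
  have : Countable ι := countable_of_orthonormal e.orthonormal
  have : Countable κ := countable_of_orthonormal f.orthonormal
  refine (isTraceClass_adjoint_comp e f (hS.summable_norm_sq e.orthonormal)
    (hT.summable_norm_sq e.orthonormal)).hasTrace_of_hasSum e ?_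
  simpa [ContinuousLinearMap.adjoint_inner_right] using hS.hasSum_inner hT e

end Carleman

section CutoffKernel

variable {X Y : Type*} {S : Set (X × Y)} {α : X → ℂ} {β : Y → ℂ}

/-- The separable kernel `α(x) β(y)` cut off to a set `S` of pairs, such as a triangle. -/
noncomputable def cutoffKernel (S : Set (X × Y)) (α : X → ℂ) (β : Y → ℂ) (x : X) : Y → ℂ :=
  (Prod.mk x ⁻¹' S).indicator fun y => α x * β y

theorem conj_cutoffKernel (x : X) (y : Y) :
    conj (cutoffKernel S α β x y) =
      cutoffKernel (Prod.swap ⁻¹' S) (fun y => conj (β y)) (fun x => conj (α x)) y x := by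
  by_cases h : (x, y) ∈ S <;> simp [cutoffKernel, indicator, h, mul_comm]

end CutoffKernel

section Kernel

variable {X Y : Type} [MeasurableSpace X] [MeasurableSpace Y] {ρ : Measure Y} {k : X → Y → ℂ}

/-- Measurable kernels `k` whose rows `k x` have uniformly bounded norm in `L²(ρ)`. -/
structure IsBddKernel (ρ : Measure Y) (k : X → Y → ℂ) : Prop where
  measurable : Measurable (Function.uncurry k)
  integrable_sq : ∀ x, Integrable (fun y => ‖k x y‖ ^ 2) ρ
  bddAbove : ∃ M, ∀ x, ∫ y, ‖k x y‖ ^ 2 ∂ρ ≤ M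

namespace IsBddKernel

theorem memLp (hk : IsBddKernel ρ k) (x : X) : MemLp (k x) 2 ρ :=
  (memLp_two_iff_integrable_sq_norm
    (hk.measurable.comp measurable_prodMk_left).aestronglyMeasurable).2 (hk.integrable_sq x)

/-- The vector `conj (k x)` of `L²(ρ)`, whose inner product with `f` is `∫ y, k x y * f y`. -/
noncomputable def representer (hk : IsBddKernel ρ k) (x : X) : Lp ℂ 2 ρ :=
  (hk.memLp x).star.toLp

theorem representer_coeFn (hk : IsBddKernel ρ k) (x : X) :
    hk.representer x =ᵐ[ρ] fun y => conj (k x y) :=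
  (hk.memLp x).star.coeFn_toLp

theorem inner_representer (hk : IsBddKernel ρ k) (x : X) (f : Lp ℂ 2 ρ) :
    inner ℂ (hk.representer x) f = ∫ y, k x y * f y ∂ρ := by
  rw [L2.inner_def]
  refine integral_congr_ae ?_
  filter_upwards [hk.representer_coeFn x] with y hy
  rw [hy, RCLike.inner_apply, RCLike.conj_conj, mul_comm]

theorem exists_norm_representer_le (hk : IsBddKernel ρ k) :
    ∃ C, ∀ x, ‖hk.representer x‖ ≤ C := by
  obtain ⟨M, hM⟩ := hk.bddAbove
  refine ⟨√M, fun x => Real.le_sqrt_of_sq_le ?_⟩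
  rw [representer, norm_sq_toLp]
  simpa only [Pi.star_apply, norm_star] using hM x

theorem memLp_inner_representer (ν : Measure X) [IsFiniteMeasure ν] [SFinite ρ]
    (hk : IsBddKernel ρ k) (f : Lp ℂ 2 ρ) : MemLp (fun x => inner ℂ (hk.representer x) f) 2 ν := by
  obtain ⟨C, hC⟩ := hk.exists_norm_representer_le
  refine .of_bound ?_ (C * ‖f‖) (.of_forall fun x =>
    (norm_inner_le_norm _ _).trans (mul_le_mul_of_nonneg_right (hC x) (norm_nonneg f)))
  simp only [hk.inner_representer]
  exact ((hk.measurable.stronglyMeasurable.mul ((Lp.stronglyMeasurable f).comp_measurable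
    measurable_snd)).integral_prod_right (f := fun x y => k x y * f y)).aestronglyMeasurable

theorem memLp_uncurry {ν : Measure X} [IsFiniteMeasure ν] [SFinite ρ] (hk : IsBddKernel ρ k) :
    MemLp (Function.uncurry k) 2 (ν.prod ρ) := by
  obtain ⟨M, hM⟩ := hk.bddAbove
  have hm := hk.measurable.aestronglyMeasurable (μ := ν.prod ρ)
  have hsq := hm.norm.pow 2
  refine (memLp_two_iff_integrable_sq_norm hm).2 ((integrable_prod_iff hsq).2
    ⟨.of_forall hk.integrable_sq, (integrable_const M).mono' hsq.norm.integral_prod_right' ?_⟩)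
  refine .of_forall fun x => ?_
  rw [Real.norm_of_nonneg (integral_nonneg fun _ => norm_nonneg _)]
  simpa using hM x

end IsBddKernel

/-- The integral operator `f ↦ ∫ y, k · y * f y` from `L²(ρ)` to `L²(ν)`. -/
noncomputable def kernelOp (ν : Measure X) [IsFiniteMeasure ν] [SFinite ρ]
    (hk : IsBddKernel ρ k) : Lp ℂ 2 ρ →L[ℂ] Lp ℂ 2 ν :=
  LinearMap.mkContinuousOfExistsBound
    { toFun := fun f => (hk.memLp_inner_representer ν f).toLp
      map_add' := fun f g => by
        rw [← MemLp.toLp_add]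
        exact MemLp.toLp_congr _ _ (.of_forall fun x => inner_add_right ..)
      map_smul' := fun c f => by
        rw [RingHom.id_apply, ← MemLp.toLp_const_smul]
        exact MemLp.toLp_congr _ _ (.of_forall fun x => inner_smul_right ..) } <| by
    obtain ⟨C, hC⟩ := hk.exists_norm_representer_le
    refine ⟨(measureUnivNNReal ν : ℝ) ^ (2 : ENNReal).toReal⁻¹ * |C|, fun f => ?_⟩
    rw [mul_assoc]
    refine Lp.norm_le_of_ae_bound (by positivity) ?_
    filter_upwards [(hk.memLp_inner_representer ν f).coeFn_toLp] with x hx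
    refine (congrArg norm hx).trans_le ((norm_inner_le_norm _ _).trans ?_)
    exact mul_le_mul_of_nonneg_right ((hC x).trans (le_abs_self C)) (norm_nonneg f)

theorem memLp_conj_mul_prod {ν : Measure X} [SFinite ρ] (f : Lp ℂ 2 ν) (g : Lp ℂ 2 ρ) :
    MemLp (fun p : X × Y => conj (f p.1) * g p.2) 2 (ν.prod ρ) := by
  have hm : AEStronglyMeasurable (fun p : X × Y => conj (f p.1) * g p.2) (ν.prod ρ) :=
    ((Lp.memLp f).star.aestronglyMeasurable.comp_fst).mul (Lp.memLp g).aestronglyMeasurable.comp_snd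
  refine (memLp_two_iff_integrable_sq_norm hm).2 ?_
  simpa only [norm_mul, mul_pow, RCLike.norm_conj] using
    ((Lp.memLp f).integrable_norm_pow two_ne_zero).mul_prod
      ((Lp.memLp g).integrable_norm_pow two_ne_zero)

variable {ν : Measure X} [IsFiniteMeasure ν]

theorem isCarleman_kernelOp [SFinite ρ] (hk : IsBddKernel ρ k) :
    IsCarleman (kernelOp ν hk) hk.representer :=
  ⟨hk.exists_norm_representer_le, fun f => (hk.memLp_inner_representer ν f).coeFn_toLp⟩

theorem kernelOp_coeFn [SFinite ρ] (hk : IsBddKernel ρ k) (f : Lp ℂ 2 ρ) :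
    kernelOp ν hk f =ᵐ[ν] fun x => ∫ y, k x y * f y ∂ρ := by
  simpa only [hk.inner_representer] using (isCarleman_kernelOp hk).2 f

theorem adjoint_kernelOp [IsFiniteMeasure ρ] (hk : IsBddKernel ρ k)
    (hk' : IsBddKernel ν fun y x => conj (k x y)) :
    (kernelOp ν hk).adjoint = kernelOp ρ hk' := by
  refine ((ContinuousLinearMap.eq_adjoint_iff _ _).2 fun f g => ?_).symm
  have hint : Integrable (fun p : X × Y => k p.1 p.2 * (conj (f p.1) * g p.2)) (ν.prod ρ) :=
    hk.memLp_uncurry.integrable_mul (memLp_conj_mul_prod f g)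
  calc inner ℂ (kernelOp ρ hk' f) g
      = ∫ y, ∫ x, k x y * (conj (f x) * g y) ∂ν ∂ρ := by
        rw [L2.inner_def]
        refine integral_congr_ae ?_
        filter_upwards [kernelOp_coeFn hk' f] with y hy
        rw [hy, RCLike.inner_apply, ← integral_conj, ← integral_const_mul]
        refine integral_congr_ae (.of_forall fun x => ?_)
        simp only [map_mul, RCLike.conj_conj]
        ring
    _ = ∫ x, ∫ y, k x y * (conj (f x) * g y) ∂ρ ∂ν := (integral_integral_swap hint).symm
    _ = inner ℂ f (kernelOp ν hk g) := by
        rw [L2.inner_def]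
        refine integral_congr_ae ?_
        filter_upwards [kernelOp_coeFn hk g] with x hx
        rw [hx, RCLike.inner_apply, ← integral_mul_const]
        refine integral_congr_ae (.of_forall fun y => ?_)
        ring

section Cutoff

variable {S : Set (X × Y)} {α : X → ℂ} {β : Y → ℂ}

theorem integral_cutoffKernel_mul (hS : MeasurableSet S) (f : Y → ℂ) (x : X) :
    ∫ y, cutoffKernel S α β x y * f y ∂ρ = α x * ∫ y in Prod.mk x ⁻¹' S, β y * f y ∂ρ := by
  simp only [cutoffKernel, ← indicator_mul_left, mul_assoc]
  rw [integral_indicator (measurable_prodMk_left hS), integral_const_mul]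

theorem isBddKernel_cutoffKernel (hS : MeasurableSet S) (hα : Measurable α) (hβ : Measurable β)
    (hint : ∀ x, IntegrableOn (fun y => ‖β y‖ ^ 2) (Prod.mk x ⁻¹' S) ρ) {M : ℝ}
    (hM : ∀ x, ‖α x‖ ^ 2 * ∫ y in Prod.mk x ⁻¹' S, ‖β y‖ ^ 2 ∂ρ ≤ M) :
    IsBddKernel ρ (cutoffKernel S α β) := by
  have hrow : ∀ x, (fun y => ‖cutoffKernel S α β x y‖ ^ 2) =
      (Prod.mk x ⁻¹' S).indicator fun y => ‖α x‖ ^ 2 * ‖β y‖ ^ 2 := by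
    intro x
    funext y
    by_cases h : (x, y) ∈ S <;> simp [cutoffKernel, indicator, h, mul_pow]
  refine ⟨?_, fun x => ?_, M, fun x => ?_⟩
  · exact ((hα.comp measurable_fst).mul (hβ.comp measurable_snd)).indicator hS
  · rw [hrow, integrable_indicator_iff (measurable_prodMk_left hS)]
    exact (hint x).const_mul _
  · rw [hrow, integral_indicator (measurable_prodMk_left hS), integral_const_mul]
    exact hM x

end Cutoff

end Kernel

section Triangle

variable {R : ℝ} {α β : ℝ → ℂ}

/-- The triangle of pairs `(r, s)` with `0 < s < r ≤ R`, on which Volterra kernels live. -/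
def triangle (R : ℝ) : Set (ℝ × ℝ) := {p | 0 < p.2 ∧ p.2 < p.1 ∧ p.1 ≤ R}

theorem measurableSet_triangle : MeasurableSet (triangle R) :=
  (measurableSet_lt measurable_const measurable_snd).inter
    ((measurableSet_lt measurable_snd measurable_fst).inter
      (measurableSet_le measurable_fst measurable_const))

theorem mk_preimage_triangle {r : ℝ} (hr : r ≤ R) : Prod.mk r ⁻¹' triangle R = Ioo 0 r := by
  ext s
  simp [triangle, hr]

theorem mk_preimage_triangle_of_notMem {r : ℝ} (hr : r ∉ Ioc 0 R) :
    Prod.mk r ⁻¹' triangle R = ∅ :=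
  eq_empty_of_forall_notMem fun _ hs => hr ⟨hs.1.trans hs.2.1, hs.2.2⟩

theorem mk_preimage_swap_triangle {s : ℝ} (hs : 0 < s) :
    Prod.mk s ⁻¹' (Prod.swap ⁻¹' triangle R) = Ioc s R := by
  ext r
  simp [triangle, hs]

theorem mk_preimage_swap_triangle_of_notMem {s : ℝ} (hs : s ∉ Ioc 0 R) :
    Prod.mk s ⁻¹' (Prod.swap ⁻¹' triangle R) = ∅ :=
  eq_empty_of_forall_notMem fun _ hr => hs ⟨hr.1, hr.2.1.le.trans hr.2.2⟩

theorem setIntegral_Icc_Ioo {E : Type*} [NormedAddCommGroup E] [NormedSpace ℝ E] (f : ℝ → E)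
    {r : ℝ} (hr : r ∈ Icc 0 R) :
    ∫ s in Ioo 0 r, f s ∂volume.restrict (Icc 0 R) = ∫ s in 0..r, f s := by
  rw [Measure.restrict_restrict_of_subset (Ioo_subset_Icc_self.trans (Icc_subset_Icc_right hr.2)),
    intervalIntegral.integral_of_le hr.1, integral_Ioc_eq_integral_Ioo]

theorem setIntegral_Icc_Ioc {E : Type*} [NormedAddCommGroup E] [NormedSpace ℝ E] (f : ℝ → E)
    {s : ℝ} (hs : s ∈ Icc 0 R) :
    ∫ r in Ioc s R, f r ∂volume.restrict (Icc 0 R) = ∫ r in s..R, f r := by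
  rw [Measure.restrict_restrict_of_subset (Ioc_subset_Icc_self.trans (Icc_subset_Icc_left hs.1)),
    intervalIntegral.integral_of_le hs.2]

theorem integral_triangle (f : ℝ → ℂ) {r : ℝ} (hr : r ∈ Icc 0 R) :
    ∫ s in Icc 0 R, cutoffKernel (triangle R) α β r s * f s = α r * ∫ s in 0..r, β s * f s := by
  rw [integral_cutoffKernel_mul measurableSet_triangle, mk_preimage_triangle hr.2,
    setIntegral_Icc_Ioo _ hr]

theorem integral_swap_triangle (f : ℝ → ℂ) {s : ℝ} (hs : s ∈ Ioc 0 R) :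
    ∫ r in Icc 0 R, cutoffKernel (Prod.swap ⁻¹' triangle R) β α s r * f r =
      β s * ∫ r in s..R, α r * f r := by
  rw [integral_cutoffKernel_mul (measurable_swap measurableSet_triangle),
    mk_preimage_swap_triangle hs.1, setIntegral_Icc_Ioc _ (Ioc_subset_Icc_self hs)]

theorem isBddKernel_triangle (hα : Measurable α) (hβ : Continuous β) {M : ℝ}
    (hM : ∀ r ∈ Ioc 0 R, ‖α r‖ ^ 2 * ∫ s in 0..r, ‖β s‖ ^ 2 ≤ M) :
    IsBddKernel (volume.restrict (Icc 0 R)) (cutoffKernel (triangle R) α β) := by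
  refine isBddKernel_cutoffKernel (M := max M 0) measurableSet_triangle hα hβ.measurable
    (fun r => ?_) fun r => ?_
  · exact ((hβ.norm.pow 2).continuousOn.integrableOn_compact isCompact_Icc).integrable.integrableOn
  · by_cases hr : r ∈ Ioc 0 R
    · rw [mk_preimage_triangle hr.2, setIntegral_Icc_Ioo _ (Ioc_subset_Icc_self hr)]
      exact le_max_of_le_left (hM r hr)
    · rw [mk_preimage_triangle_of_notMem hr]
      simp

theorem isBddKernel_swap_triangle (hα : Measurable α) (hα' : ContinuousOn α (Ioi 0))
    (hβ : Measurable β) {M : ℝ} (hM : ∀ s ∈ Ioc 0 R, ‖β s‖ ^ 2 * ∫ r in s..R, ‖α r‖ ^ 2 ≤ M) :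
    IsBddKernel (volume.restrict (Icc 0 R)) (cutoffKernel (Prod.swap ⁻¹' triangle R) β α) := by
  refine isBddKernel_cutoffKernel (M := max M 0) (measurable_swap measurableSet_triangle) hβ hα
    (fun s => ?_) fun s => ?_
  all_goals by_cases hs : s ∈ Ioc 0 R
  · have hsub : Icc s R ⊆ Ioi 0 := fun r hr => hs.1.trans_le hr.1
    rw [mk_preimage_swap_triangle hs.1]
    exact (((hα'.mono hsub).norm.pow 2).integrableOn_compact isCompact_Icc).mono
      Ioc_subset_Icc_self Measure.restrict_le_self
  · rw [mk_preimage_swap_triangle_of_notMem hs]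
    exact integrableOn_empty
  · rw [mk_preimage_swap_triangle hs.1, setIntegral_Icc_Ioc _ (Ioc_subset_Icc_self hs)]
    exact le_max_of_le_left (hM s hs)
  · rw [mk_preimage_swap_triangle_of_notMem hs]
    simp

/-- The kernel of `g ↦ √r ∫₀ʳ g`. -/
noncomputable def outerKernel (R : ℝ) : ℝ → ℝ → ℂ :=
  cutoffKernel (triangle R) (fun r => (√r : ℂ)) fun _ => 1

/-- The kernel of `f ↦ -(1/s) ∫₀ˢ √t f(t) dt`. -/
noncomputable def innerKernel (R : ℝ) : ℝ → ℝ → ℂ :=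
  cutoffKernel (triangle R) (fun s => -(s : ℂ)⁻¹) fun t => (√t : ℂ)

theorem norm_ofReal_sqrt_sq {r : ℝ} (hr : 0 ≤ r) : ‖(√r : ℂ)‖ ^ 2 = r := by
  rw [Complex.norm_real, Real.norm_of_nonneg (Real.sqrt_nonneg r), Real.sq_sqrt hr]

theorem integral_norm_ofReal_sqrt_sq {a b : ℝ} (ha : 0 ≤ a) (hab : a ≤ b) :
    ∫ r in a..b, ‖(√r : ℂ)‖ ^ 2 = (b ^ 2 - a ^ 2) / 2 := by
  rw [← integral_id]
  refine intervalIntegral.integral_congr fun r hr => norm_ofReal_sqrt_sq ?_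
  rw [uIcc_of_le hab] at hr
  exact ha.trans hr.1

theorem isBddKernel_outerKernel : IsBddKernel (volume.restrict (Icc 0 R)) (outerKernel R) := by
  refine isBddKernel_triangle (M := R ^ 2) (by fun_prop) continuous_const fun r hr => ?_
  rw [norm_ofReal_sqrt_sq hr.1.le]
  simpa [sq] using mul_self_le_mul_self hr.1.le hr.2

theorem isBddKernel_conj_outerKernel :
    IsBddKernel (volume.restrict (Icc 0 R)) fun s r => conj (outerKernel R r s) := by
  simp only [outerKernel, conj_cutoffKernel, Complex.conj_ofReal, map_one]
  refine isBddKernel_swap_triangle (M := R ^ 2 / 2) (by fun_prop)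
    (Continuous.continuousOn (by fun_prop)) (by fun_prop) fun s hs => ?_
  rw [integral_norm_ofReal_sqrt_sq hs.1.le hs.2, norm_one, one_pow, one_mul]
  gcongr
  exact sub_le_self _ (sq_nonneg s)

theorem isBddKernel_innerKernel : IsBddKernel (volume.restrict (Icc 0 R)) (innerKernel R) := by
  refine isBddKernel_triangle (M := 1 / 2) (by fun_prop) (by fun_prop) fun s hs => ?_
  rw [integral_norm_ofReal_sqrt_sq le_rfl hs.1.le, norm_neg, norm_inv, Complex.norm_real,
    Real.norm_of_nonneg hs.1.le]
  have := hs.1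
  exact le_of_eq (by field_simp; ring)

theorem isBddKernel_conj_innerKernel :
    IsBddKernel (volume.restrict (Icc 0 R)) fun t s => conj (innerKernel R s t) := by
  simp only [innerKernel, conj_cutoffKernel, Complex.conj_ofReal, map_neg, map_inv₀]
  have hcont : ContinuousOn (fun s : ℝ => -(s : ℂ)⁻¹) (Ioi 0) :=
    (Complex.continuous_ofReal.continuousOn.inv₀ fun s hs => by exact_mod_cast ne_of_gt hs).neg
  refine isBddKernel_swap_triangle (M := 1) (by fun_prop) hcont (by fun_prop) fun t ht => ?_
  have hpow : ∫ s in t..R, ‖-(s : ℂ)⁻¹‖ ^ 2 = t⁻¹ - R⁻¹ := by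
    have hcongr : ∀ s ∈ uIcc t R, ‖-(s : ℂ)⁻¹‖ ^ 2 = s ^ (-2 : ℤ) := fun s _ => by
      rw [norm_neg, norm_inv, Complex.norm_real, inv_pow, Real.norm_eq_abs, sq_abs, zpow_neg,
        zpow_ofNat]
    rw [intervalIntegral.integral_congr hcongr, integral_zpow (.inr ⟨by norm_num, fun h => ?_⟩)]
    · norm_num [zpow_neg_one, div_neg]
    · rw [uIcc_of_le ht.2] at h
      exact ht.1.not_ge h.1
  rw [norm_ofReal_sqrt_sq ht.1.le, hpow]
  refine (mul_le_mul_of_nonneg_left (sub_le_self _ (inv_nonneg.2 (ht.1.le.trans ht.2)))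
    ht.1.le).trans_eq (mul_inv_cancel₀ ht.1.ne')

end Triangle

section VolterraFunction

variable {R : ℝ} (g : L2Interval R) {r s : ℝ}

/-- `∫₀ˢ √t g(t) dt`, with `g` extended by zero. -/
noncomputable def innerPrimitive (g : L2Interval R) (s : ℝ) : ℂ :=
  ∫ t in 0..s, (√t : ℂ) * (Icc 0 R).indicator g t

/-- `∫₀ʳ s⁻¹ ∫₀ˢ √t g(t) dt ds`, with `g` extended by zero. -/
noncomputable def outerPrimitive (g : L2Interval R) (r : ℝ) : ℂ :=
  ∫ s in 0..r, (s : ℂ)⁻¹ * innerPrimitive g s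

/-- The solution `v(r) = -√r ∫₀ʳ s⁻¹ ∫₀ˢ √t g(t) dt ds` of `Δv = g` given by variation of
constants; it vanishes for `r ≤ 0`. -/
noncomputable def volterraFun (g : L2Interval R) (r : ℝ) : ℂ :=
  -((√r : ℂ) * outerPrimitive g r)

/-- The derivative of `volterraFun g`. -/
noncomputable def volterraDeriv (g : L2Interval R) (r : ℝ) : ℂ :=
  -(1 / (2 * (√r : ℂ)) * outerPrimitive g r + (√r : ℂ) * ((r : ℂ)⁻¹ * innerPrimitive g r))

theorem hasDerivAt_ofReal_sqrt (hr : 0 < r) :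
    HasDerivAt (fun r : ℝ => (√r : ℂ)) (1 / (2 * (√r : ℂ))) r := by
  simpa using (Real.hasDerivAt_sqrt hr.ne').ofReal_comp

theorem norm_ofReal_sqrt (r : ℝ) : ‖(√r : ℂ)‖ = √r := by
  rw [Complex.norm_real, Real.norm_of_nonneg (Real.sqrt_nonneg r)]

theorem memLp_ofReal_sqrt :
    MemLp (fun t : ℝ => (√t : ℂ)) 2 (volume.restrict (Icc (0 : ℝ) R)) := by
  refine .of_bound (by fun_prop) (√R) ?_
  filter_upwards [ae_restrict_mem measurableSet_Icc] with t ht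
  rw [norm_ofReal_sqrt]
  exact Real.sqrt_le_sqrt ht.2

theorem integrable_sqrt_mul_indicator :
    Integrable fun t => (√t : ℂ) * (Icc 0 R).indicator g t := by
  simp only [← indicator_mul_right _ fun t => (√t : ℂ)]
  rw [integrable_indicator_iff measurableSet_Icc]
  exact memLp_ofReal_sqrt.integrable_mul (Lp.memLp g)

theorem continuous_innerPrimitive : Continuous (innerPrimitive g) :=
  intervalIntegral.continuous_primitive
    (fun _ _ => (integrable_sqrt_mul_indicator g).intervalIntegrable) 0

theorem innerPrimitive_eq (hs : s ∈ Icc 0 R) :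
    innerPrimitive g s = ∫ t in 0..s, (√t : ℂ) * g t := by
  refine intervalIntegral.integral_congr fun t ht => ?_
  rw [uIcc_of_le hs.1] at ht
  simp only [indicator_of_mem (show t ∈ Icc 0 R from ⟨ht.1, ht.2.trans hs.2⟩)]

theorem norm_innerPrimitive_le (hs : 0 ≤ s) : ‖innerPrimitive g s‖ ≤ s * ‖g‖ := by
  have heq : innerPrimitive g s =
      ∫ t in Icc 0 R, (Ioc 0 s).indicator (fun t => (√t : ℂ)) t * g t := by
    rw [innerPrimitive, intervalIntegral.integral_of_le hs, ← integral_indicator measurableSet_Ioc,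
      ← integral_indicator measurableSet_Icc]
    congr 1 with t
    by_cases ht : t ∈ Ioc 0 s <;> by_cases ht' : t ∈ Icc 0 R <;> simp [ht, ht']
  have hsq : ∫ t in Icc 0 R, ‖(Ioc 0 s).indicator (fun t => (√t : ℂ)) t‖ ^ 2 ≤ s ^ 2 :=
    calc ∫ t in Icc 0 R, ‖(Ioc 0 s).indicator (fun t => (√t : ℂ)) t‖ ^ 2
        = ∫ t in Ioc 0 s, ‖(√t : ℂ)‖ ^ 2 ∂volume.restrict (Icc 0 R) := by
          rw [← integral_indicator measurableSet_Ioc]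
          congr 1 with t
          by_cases ht : t ∈ Ioc 0 s <;> simp [ht]
      _ ≤ ∫ t in Ioc 0 s, ‖(√t : ℂ)‖ ^ 2 :=
          integral_mono_measure (Measure.restrict_mono_measure Measure.restrict_le_self _)
            (.of_forall fun t => sq_nonneg _) (Continuous.integrableOn_Ioc (by fun_prop))
      _ = s ^ 2 / 2 := by
          rw [← intervalIntegral.integral_of_le hs, integral_norm_ofReal_sqrt_sq le_rfl hs]
          ring
      _ ≤ s ^ 2 := half_le_self (sq_nonneg s)
  rw [heq]
  refine (norm_integral_mul_le (memLp_ofReal_sqrt.indicator measurableSet_Ioc) g).trans ?_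
  gcongr
  exact Real.sqrt_le_iff.2 ⟨hs, hsq⟩

theorem norm_inv_mul_innerPrimitive_le (hs : 0 ≤ s) :
    ‖(s : ℂ)⁻¹ * innerPrimitive g s‖ ≤ ‖g‖ := by
  rcases hs.eq_or_lt with rfl | hs'
  · simp
  rw [norm_mul, norm_inv, Complex.norm_real, Real.norm_of_nonneg hs, inv_mul_le_iff₀ hs']
  exact norm_innerPrimitive_le g hs

theorem measurable_inv_mul_innerPrimitive :
    Measurable fun s : ℝ => (s : ℂ)⁻¹ * innerPrimitive g s :=
  Complex.measurable_ofReal.inv.mul (continuous_innerPrimitive g).measurable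

theorem continuousAt_inv_mul_innerPrimitive (hs : s ≠ 0) :
    ContinuousAt (fun s : ℝ => (s : ℂ)⁻¹ * innerPrimitive g s) s :=
  (Complex.continuous_ofReal.continuousAt.inv₀ (by exact_mod_cast hs)).mul
    (continuous_innerPrimitive g).continuousAt

theorem intervalIntegrable_inv_mul_innerPrimitive (hr : 0 ≤ r) :
    IntervalIntegrable (fun s : ℝ => (s : ℂ)⁻¹ * innerPrimitive g s) volume 0 r := by
  rw [intervalIntegrable_iff_integrableOn_Ioc_of_le hr]
  refine Measure.integrableOn_of_bounded (M := ‖g‖) (by simp)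
    (measurable_inv_mul_innerPrimitive g).aestronglyMeasurable ?_
  filter_upwards [ae_restrict_mem measurableSet_Ioc] with s hs
  exact norm_inv_mul_innerPrimitive_le g hs.1.le

theorem norm_outerPrimitive_le (hr : 0 ≤ r) : ‖outerPrimitive g r‖ ≤ r * ‖g‖ := by
  have hle : ∀ s ∈ uIoc 0 r, ‖(s : ℂ)⁻¹ * innerPrimitive g s‖ ≤ ‖g‖ := fun s hs =>
    norm_inv_mul_innerPrimitive_le g (uIoc_of_le hr ▸ hs).1.le
  refine (intervalIntegral.norm_integral_le_of_norm_le_const hle).trans_eq ?_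
  rw [sub_zero, abs_of_nonneg hr, mul_comm]

theorem hasDerivAt_outerPrimitive (hr : 0 < r) :
    HasDerivAt (outerPrimitive g) ((r : ℂ)⁻¹ * innerPrimitive g r) r :=
  intervalIntegral.integral_hasDerivAt_right
    (intervalIntegrable_inv_mul_innerPrimitive g hr.le)
    (measurable_inv_mul_innerPrimitive g).stronglyMeasurable.stronglyMeasurableAtFilter
    (continuousAt_inv_mul_innerPrimitive g hr.ne')

theorem volterraFun_of_nonpos (hr : r ≤ 0) : volterraFun g r = 0 := by
  simp [volterraFun, Real.sqrt_eq_zero_of_nonpos hr]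

theorem volterraDeriv_of_nonpos (hr : r ≤ 0) : volterraDeriv g r = 0 := by
  simp [volterraDeriv, Real.sqrt_eq_zero_of_nonpos hr]

theorem norm_volterraFun_le (r : ℝ) : ‖volterraFun g r‖ ≤ ‖g‖ * (√r * |r|) := by
  rcases le_or_gt r 0 with hr | hr
  · simp [volterraFun_of_nonpos g hr, Real.sqrt_eq_zero_of_nonpos hr]
  rw [volterraFun, norm_neg, norm_mul, norm_ofReal_sqrt, abs_of_pos hr, mul_left_comm, mul_comm ‖g‖]
  exact mul_le_mul_of_nonneg_left (norm_outerPrimitive_le g hr.le) (Real.sqrt_nonneg _)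

theorem norm_volterraDeriv_le (r : ℝ) : ‖volterraDeriv g r‖ ≤ 2 * ‖g‖ * √r := by
  rcases le_or_gt r 0 with hr | hr
  · simp [volterraDeriv_of_nonpos g hr, Real.sqrt_eq_zero_of_nonpos hr]
  have hs : 0 < √r := Real.sqrt_pos.2 hr
  calc ‖volterraDeriv g r‖
      ≤ 1 / (2 * √r) * ‖outerPrimitive g r‖ + √r * ‖(r : ℂ)⁻¹ * innerPrimitive g r‖ := by
        rw [volterraDeriv, norm_neg]
        refine (norm_add_le _ _).trans_eq ?_
        simp only [norm_mul, norm_div, norm_one, RCLike.norm_ofNat, norm_ofReal_sqrt]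
    _ ≤ 1 / (2 * √r) * (√r ^ 2 * ‖g‖) + √r * ‖g‖ := by
        rw [Real.sq_sqrt hr.le]
        gcongr
        · exact norm_outerPrimitive_le g hr.le
        · exact norm_inv_mul_innerPrimitive_le g hr.le
    _ = 3 / 2 * (‖g‖ * √r) := by field_simp; ring
    _ ≤ 2 * ‖g‖ * √r := by nlinarith [mul_nonneg (norm_nonneg g) hs.le]

theorem continuousAt_zero_of_norm_le {f : ℝ → ℂ} {b : ℝ → ℝ} (hb : Continuous b) (hb0 : b 0 = 0)
    (hf : ∀ r, ‖f r‖ ≤ b r) : ContinuousAt f 0 := by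
  have hf0 : f 0 = 0 := norm_le_zero_iff.1 ((hf 0).trans_eq hb0)
  rw [ContinuousAt, hf0]
  exact squeeze_zero_norm hf (hb.tendsto' 0 0 hb0)

theorem hasDerivAt_volterraFun_of_ne_zero (hr : r ≠ 0) :
    HasDerivAt (volterraFun g) (volterraDeriv g r) r := by
  rcases hr.lt_or_gt with hr | hr
  · rw [volterraDeriv_of_nonpos g hr.le]
    refine (hasDerivAt_const r (0 : ℂ)).congr_of_eventuallyEq ?_
    filter_upwards [Iio_mem_nhds hr] with x hx using volterraFun_of_nonpos g (le_of_lt hx)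
  · exact ((hasDerivAt_ofReal_sqrt hr).mul (hasDerivAt_outerPrimitive g hr)).neg

theorem hasDerivAt_volterraFun (r : ℝ) : HasDerivAt (volterraFun g) (volterraDeriv g r) r := by
  rcases eq_or_ne r 0 with rfl | hr
  · exact hasDerivAt_of_hasDerivAt_of_ne (fun r hr => hasDerivAt_volterraFun_of_ne_zero g hr)
      (continuousAt_zero_of_norm_le (by fun_prop) (by simp) (norm_volterraFun_le g))
      (continuousAt_zero_of_norm_le (by fun_prop) (by simp) (norm_volterraDeriv_le g))
  · exact hasDerivAt_volterraFun_of_ne_zero g hr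

theorem continuous_volterraDeriv : Continuous (volterraDeriv g) := by
  refine continuous_iff_continuousAt.2 fun r => ?_
  rcases lt_trichotomy r 0 with hr | rfl | hr
  · refine (continuousAt_const (y := (0 : ℂ))).congr ?_
    filter_upwards [Iio_mem_nhds hr] with x hx using (volterraDeriv_of_nonpos g (le_of_lt hx)).symm
  · exact continuousAt_zero_of_norm_le (by fun_prop) (by simp) (norm_volterraDeriv_le g)
  · have hs : 2 * (√r : ℂ) ≠ 0 := by exact_mod_cast (by positivity : 2 * √r ≠ 0)
    have hinv : ContinuousAt (fun r : ℝ => 1 / (2 * (√r : ℂ))) r :=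
      continuousAt_const.div (by fun_prop) hs
    exact ((hinv.mul (hasDerivAt_outerPrimitive g hr).continuousAt).add
      (ContinuousAt.mul (by fun_prop) (continuousAt_inv_mul_innerPrimitive g hr.ne'))).neg

end VolterraFunction

section VolterraOperator

variable {R : ℝ} (g : L2Interval R)

/-- `g ↦ √r ∫₀ʳ g` on `L²([0,R])`. -/
noncomputable def outerOp (R : ℝ) : L2Interval R →L[ℂ] L2Interval R :=
  kernelOp _ isBddKernel_outerKernel

/-- `f ↦ -(1/s) ∫₀ˢ √t f(t) dt` on `L²([0,R])`. -/
noncomputable def innerOp (R : ℝ) : L2Interval R →L[ℂ] L2Interval R :=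
  kernelOp _ isBddKernel_innerKernel

/-- The right inverse of `Δ` with vanishing boundary data at `r = 0`. -/
noncomputable def volterraOp (R : ℝ) : L2Interval R →L[ℂ] L2Interval R :=
  outerOp R ∘L innerOp R

/-- The value at `R` of the continuous representative of `volterraOp R g`, as a bounded functional
of `g`. -/
noncomputable def endpointEval (R : ℝ) : L2Interval R →L[ℂ] ℂ :=
  innerSL ℂ (isBddKernel_outerKernel.representer R) ∘L innerOp R

theorem innerOp_coeFn :
    innerOp R g =ᵐ[volume.restrict (Icc 0 R)] fun s => -((s : ℂ)⁻¹ * innerPrimitive g s) := by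
  filter_upwards [kernelOp_coeFn isBddKernel_innerKernel g, ae_restrict_mem measurableSet_Icc]
    with s hs hs'
  rw [innerOp, hs, innerKernel, integral_triangle _ hs', innerPrimitive_eq g hs', neg_mul]

theorem integral_outerKernel_innerOp {r : ℝ} (hr : r ∈ Icc 0 R) :
    ∫ s in Icc 0 R, outerKernel R r s * innerOp R g s = volterraFun g r := by
  have hcongr : (fun s => outerKernel R r s * innerOp R g s) =ᵐ[volume.restrict (Icc 0 R)]
      fun s => outerKernel R r s * -((s : ℂ)⁻¹ * innerPrimitive g s) := by
    filter_upwards [innerOp_coeFn g] with s hs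
    rw [hs]
  rw [integral_congr_ae hcongr, outerKernel, integral_triangle _ hr, volterraFun, outerPrimitive]
  simp only [one_mul, intervalIntegral.integral_neg, mul_neg]

theorem volterraOp_coeFn : volterraOp R g =ᵐ[volume.restrict (Icc 0 R)] volterraFun g := by
  filter_upwards [kernelOp_coeFn isBddKernel_outerKernel (innerOp R g),
    ae_restrict_mem measurableSet_Icc] with r hr hr'
  exact hr.trans (integral_outerKernel_innerOp g hr')

theorem endpointEval_apply (hR : 0 ≤ R) : endpointEval R g = volterraFun g R := by
  rw [← integral_outerKernel_innerOp g (right_mem_Icc.2 hR)]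
  exact isBddKernel_outerKernel.inner_representer R (innerOp R g)

theorem contDiff_volterraFun : ContDiff ℝ 1 (volterraFun g) := by
  have hderiv : deriv (volterraFun g) = volterraDeriv g :=
    funext fun r => (hasDerivAt_volterraFun g r).deriv
  exact contDiff_one_iff_deriv.2 ⟨fun r => (hasDerivAt_volterraFun g r).differentiableAt,
    hderiv ▸ continuous_volterraDeriv g⟩

theorem hasBoundaryData_volterraOp (hR : 0 < R) :
    HasBoundaryData R (volterraOp R g) 0 0 (endpointEval R g) := by
  refine ⟨volterraFun g, (contDiff_volterraFun g).contDiffOn, ?_, ?_, ?_, ?_⟩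
  · refine IsBigO.of_bound ‖g‖ ?_
    filter_upwards [self_mem_nhdsWithin] with r (hr : 0 < r)
    have hpow : r ^ (3 / 2 : ℝ) = √r * |r| := by
      rw [show (3 / 2 : ℝ) = 1 / 2 + 1 by norm_num, Real.rpow_add hr, Real.rpow_one,
        Real.sqrt_eq_rpow, abs_of_pos hr]
    rw [hpow, Real.norm_of_nonneg (by positivity)]
    exact norm_volterraFun_le g r
  · refine IsBigO.of_bound (2 * ‖g‖) ?_
    filter_upwards [Ioo_mem_nhdsGT hR] with r hr
    rw [derivWithin_of_mem_nhds (Icc_mem_nhds hr.1 hr.2), (hasDerivAt_volterraFun g r).deriv,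
      ← Real.sqrt_eq_rpow, Real.norm_of_nonneg (Real.sqrt_nonneg _)]
    exact norm_volterraDeriv_le g r
  · filter_upwards [volterraOp_coeFn g] with r hr
    simp [hr]
  · simp [endpointEval_apply g hR.le]

end VolterraOperator

section VolterraResolvent

variable {R : ℝ} {f : L2Interval R}

theorem norm_innerPrimitive_le_pow {M : ℝ} (hM : 0 ≤ M) {n : ℕ}
    (hf : ∀ᵐ t ∂volume.restrict (Icc 0 R), ‖f t‖ ≤ M * t ^ n) {s : ℝ} (hs : s ∈ Icc 0 R) :
    ‖innerPrimitive f s‖ ≤ s * (√R * M * s ^ n) := by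
  have hle : ‖innerPrimitive f s‖ ≤ ∫ _ in 0..s, √R * M * s ^ n := by
    refine intervalIntegral.norm_integral_le_of_norm_le hs.1 ?_ (by simp)
    filter_upwards [(ae_restrict_iff' measurableSet_Icc).1 hf] with t ht hts
    have htR : t ∈ Icc 0 R := ⟨hts.1.le, hts.2.trans hs.2⟩
    rw [indicator_of_mem htR, norm_mul, norm_ofReal_sqrt, mul_assoc]
    refine mul_le_mul (Real.sqrt_le_sqrt htR.2) ((ht htR).trans ?_) (norm_nonneg _)
      (Real.sqrt_nonneg _)
    exact mul_le_mul_of_nonneg_left (pow_le_pow_left₀ htR.1 hts.2 n) hM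
  rwa [intervalIntegral.integral_const, sub_zero, smul_eq_mul] at hle

theorem norm_outerPrimitive_le_pow {M : ℝ} (hM : 0 ≤ M) {n : ℕ}
    (hf : ∀ᵐ t ∂volume.restrict (Icc 0 R), ‖f t‖ ≤ M * t ^ n) {r : ℝ} (hr : r ∈ Icc 0 R) :
    ‖outerPrimitive f r‖ ≤ √R * M * (r ^ (n + 1) / (n + 1)) := by
  have hle : ‖outerPrimitive f r‖ ≤ ∫ s in 0..r, √R * M * s ^ n := by
    refine intervalIntegral.norm_integral_le_of_norm_le hr.1 ?_
      (Continuous.intervalIntegrable (by fun_prop) _ _)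
    filter_upwards with s hs
    rw [norm_mul, norm_inv, Complex.norm_real, Real.norm_of_nonneg hs.1.le, inv_mul_le_iff₀ hs.1]
    exact norm_innerPrimitive_le_pow hM hf ⟨hs.1.le, hs.2.trans hr.2⟩
  simpa [intervalIntegral.integral_const_mul, integral_pow] using hle

theorem norm_volterraFun_le_pow {M : ℝ} (hM : 0 ≤ M) {n : ℕ}
    (hf : ∀ᵐ t ∂volume.restrict (Icc 0 R), ‖f t‖ ≤ M * t ^ n) {r : ℝ} (hr : r ∈ Icc 0 R) :
    ‖volterraFun f r‖ ≤ R * M / (n + 1) * r ^ (n + 1) :=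
  calc ‖volterraFun f r‖ = √r * ‖outerPrimitive f r‖ := by
        rw [volterraFun, norm_neg, norm_mul, norm_ofReal_sqrt]
    _ ≤ √R * (√R * M * (r ^ (n + 1) / (n + 1))) :=
        mul_le_mul (Real.sqrt_le_sqrt hr.2) (norm_outerPrimitive_le_pow hM hf hr) (norm_nonneg _)
          (Real.sqrt_nonneg _)
    _ = √R * √R * M / (n + 1) * r ^ (n + 1) := by ring
    _ = R * M / (n + 1) * r ^ (n + 1) := by rw [Real.mul_self_sqrt (hr.1.trans hr.2)]

theorem volterraOp_pow_succ_apply (f : L2Interval R) (n : ℕ) :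
    (volterraOp R ^ (n + 1)) f = volterraOp R ((volterraOp R ^ n) f) := by
  rw [pow_succ', mul_apply_eq_comp]

theorem norm_volterraOp_pow_apply_le (f : L2Interval R) (n : ℕ) :
    ∀ᵐ r ∂volume.restrict (Icc 0 R),
      ‖(volterraOp R ^ (n + 1)) f r‖ ≤ √R * |R| * ‖f‖ * (|R| ^ n / n.factorial) * r ^ n := by
  induction n with
  | zero =>
    rw [zero_add, pow_one]
    filter_upwards [volterraOp_coeFn f, ae_restrict_mem measurableSet_Icc] with r hr hr'
    have hrR : |r| ≤ |R| := abs_le_abs_of_nonneg hr'.1 hr'.2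
    calc ‖volterraOp R f r‖ ≤ ‖f‖ * (√r * |r|) := hr ▸ norm_volterraFun_le f r
      _ ≤ ‖f‖ * (√R * |R|) := by gcongr; exact hr'.2
      _ = √R * |R| * ‖f‖ * (|R| ^ 0 / Nat.factorial 0) * r ^ 0 := by simp [mul_comm]
  | succ n ih =>
    rw [volterraOp_pow_succ_apply]
    filter_upwards [volterraOp_coeFn ((volterraOp R ^ (n + 1)) f),
      ae_restrict_mem measurableSet_Icc] with r hr hr'
    rw [hr]
    refine (norm_volterraFun_le_pow (by positivity) ih hr').trans_eq ?_
    rw [Nat.factorial_succ, abs_of_nonneg (hr'.1.trans hr'.2)]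
    push_cast
    field_simp
    ring

theorem norm_volterraOp_pow_le (n : ℕ) :
    ‖volterraOp R ^ (n + 1)‖ ≤
      (measureUnivNNReal (volume.restrict (Icc 0 R)) : ℝ) ^ (2 : ENNReal).toReal⁻¹ *
        (√R * |R|) * ((|R| * |R|) ^ n / n.factorial) := by
  refine ContinuousLinearMap.opNorm_le_bound _ (by positivity) fun f => ?_
  have hbound : ∀ᵐ r ∂volume.restrict (Icc 0 R), ‖(volterraOp R ^ (n + 1)) f r‖ ≤
      √R * |R| * ‖f‖ * (|R| ^ n / n.factorial) * |R| ^ n := by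
    filter_upwards [norm_volterraOp_pow_apply_le f n, ae_restrict_mem measurableSet_Icc]
      with r hr hr'
    refine hr.trans (mul_le_mul_of_nonneg_left ?_ (by positivity))
    exact pow_le_pow_left₀ hr'.1 (hr'.2.trans (le_abs_self R)) n
  refine (Lp.norm_le_of_ae_bound (by positivity) hbound).trans_eq ?_
  rw [mul_pow]
  ring

theorem summable_smul_volterraOp_pow (z : ℂ) : Summable fun n : ℕ => (z • volterraOp R) ^ n := by
  rw [← summable_nat_add_iff 1]
  refine Summable.of_norm_bounded ((Real.summable_pow_div_factorial (‖z‖ * (|R| * |R|))).mul_left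
    (‖z‖ * ((measureUnivNNReal (volume.restrict (Icc 0 R)) : ℝ) ^ (2 : ENNReal).toReal⁻¹ *
        (√R * |R|)))) fun n => ?_
  rw [smul_pow, norm_smul, norm_pow]
  refine (mul_le_mul_of_nonneg_left (norm_volterraOp_pow_le n) (by positivity)).trans_eq ?_
  rw [mul_pow ‖z‖]
  ring

theorem isUnit_one_sub_smul_volterraOp (z : ℂ) : IsUnit (1 - z • volterraOp R) :=
  isUnit_iff_exists.2 ⟨_, (summable_smul_volterraOp_pow z).one_sub_mul_tsum_pow,
    (summable_smul_volterraOp_pow z).tsum_pow_mul_one_sub⟩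

/-- The operator `(1 - z V)⁻¹`, where `V` is `volterraOp R`; it exists for every `z` because `V` is
quasi-nilpotent. -/
noncomputable def volterraResolvent (R : ℝ) (z : ℂ) : L2Interval R →L[ℂ] L2Interval R :=
  Ring.inverse (1 - z • volterraOp R)

theorem volterraResolvent_apply (z : ℂ) (f : L2Interval R) :
    volterraResolvent R z f = f + volterraOp R (z • volterraResolvent R z f) := by
  have h := congr($(Ring.mul_inverse_cancel _ (isUnit_one_sub_smul_volterraOp (R := R) z)) f)
  rw [map_smul, ← sub_eq_iff_eq_add]
  exact h

theorem volterraResolvent_sub_volterraOp (z : ℂ) (f : L2Interval R) :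
    volterraResolvent R z (f - volterraOp R (z • f)) = f := by
  have h := congr($(Ring.inverse_mul_cancel _ (isUnit_one_sub_smul_volterraOp (R := R) z)) f)
  rw [map_smul]
  exact h

theorem hasSum_volterraResolvent_apply (z : ℂ) (f : L2Interval R) :
    HasSum (fun n : ℕ => z ^ n • (volterraOp R ^ n) f) (volterraResolvent R z f) := by
  have hinv : volterraResolvent R z = ∑' n : ℕ, (z • volterraOp R) ^ n :=
    (isUnit_one_sub_smul_volterraOp z).mul_left_cancel
      ((Ring.mul_inverse_cancel _ (isUnit_one_sub_smul_volterraOp z)).trans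
        (summable_smul_volterraOp_pow z).one_sub_mul_tsum_pow.symm)
  rw [hinv]
  simp only [smul_pow]
  have hsum := (summable_smul_volterraOp_pow (R := R) z).hasSum
  simp only [smul_pow] at hsum
  exact hsum.mapL (ContinuousLinearMap.apply ℂ _ f)

theorem hasDerivAt_volterraResolvent (z : ℂ) :
    HasDerivAt (volterraResolvent R)
      (volterraResolvent R z ∘L volterraOp R ∘L volterraResolvent R z) z := by
  have hsub : HasDerivAt (fun w : ℂ => 1 - w • volterraOp R) (-volterraOp R) z := by
    simpa using ((hasDerivAt_id z).smul_const (volterraOp R)).const_sub 1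
  obtain ⟨u, hu⟩ := isUnit_one_sub_smul_volterraOp (R := R) z
  have hinv := hasFDerivAt_ringInverse (𝕜 := ℂ) u
  rw [hu] at hinv
  refine (hinv.comp_hasDerivAt z hsub).congr_deriv ?_
  rw [volterraResolvent, ← hu, Ring.inverse_unit]
  simp [ContinuousLinearMap.mul_def, ContinuousLinearMap.comp_assoc]

end VolterraResolvent

section Causality

variable {R : ℝ} {f : L2Interval R} {x : ℝ}

theorem volterraFun_eq_zero_of_ae_eq_zero
    (hf : ∀ᵐ t ∂volume.restrict (Icc 0 R), t ≤ x → f t = 0) {r : ℝ} (hr : r ∈ Icc 0 R)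
    (hrx : r ≤ x) : volterraFun f r = 0 := by
  have hinner : ∀ s ∈ Icc 0 r, innerPrimitive f s = 0 := by
    intro s hs
    refine (intervalIntegral.integral_congr_ae ?_).trans intervalIntegral.integral_zero
    filter_upwards [(ae_restrict_iff' measurableSet_Icc).1 hf] with t ht hts
    rw [uIoc_of_le hs.1] at hts
    have htR : t ∈ Icc 0 R := ⟨hts.1.le, hts.2.trans (hs.2.trans hr.2)⟩
    rw [indicator_of_mem htR, ht htR (hts.2.trans (hs.2.trans hrx)), mul_zero]
  have houter : outerPrimitive f r = 0 := by
    refine (intervalIntegral.integral_congr fun s hs => ?_).trans intervalIntegral.integral_zero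
    rw [uIcc_of_le hr.1] at hs
    simp only [hinner s hs, mul_zero]
  rw [volterraFun, houter, mul_zero, neg_zero]

theorem volterraOp_pow_ae_eq_zero (hf : ∀ᵐ t ∂volume.restrict (Icc 0 R), t ≤ x → f t = 0)
    (n : ℕ) : ∀ᵐ t ∂volume.restrict (Icc 0 R), t ≤ x → (volterraOp R ^ n) f t = 0 := by
  induction n with
  | zero => simpa using hf
  | succ n ih =>
    rw [volterraOp_pow_succ_apply]
    filter_upwards [volterraOp_coeFn ((volterraOp R ^ n) f), ae_restrict_mem measurableSet_Icc]
      with r hr hr' hrx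
    rw [hr, volterraFun_eq_zero_of_ae_eq_zero ih hr' hrx]

/- `V` only looks to the left: the resolvent of a function supported in `[x, R]` is supported
there, whereas the row `innerKernel R x` is supported in `[0, x]`. -/
theorem inner_representer_volterraResolvent_eq_zero
    (hf : ∀ᵐ t ∂volume.restrict (Icc 0 R), t ≤ x → f t = 0) (z : ℂ) :
    inner ℂ (isBddKernel_innerKernel.representer x) (volterraResolvent R z f) = 0 := by
  have hterm : ∀ n : ℕ, innerSL ℂ (isBddKernel_innerKernel.representer x)
      (z ^ n • (volterraOp R ^ n) f) = 0 := by
    intro n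
    rw [map_smul, innerSL_apply_apply, isBddKernel_innerKernel.inner_representer,
      integral_eq_zero_of_ae, smul_zero]
    filter_upwards [volterraOp_pow_ae_eq_zero hf n] with t ht
    by_cases htx : t ≤ x
    · rw [ht htx, mul_zero, Pi.zero_apply]
    · have : (x, t) ∉ triangle R := fun h => htx h.2.1.le
      simp [innerKernel, cutoffKernel, this]
  have hsum := (hasSum_volterraResolvent_apply z f).mapL
    (innerSL ℂ (isBddKernel_innerKernel.representer x))
  simp only [hterm] at hsum
  exact hsum.unique hasSum_zero

theorem representer_conj_outerKernel_ae_eq_zero :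
    ∀ᵐ t ∂volume.restrict (Icc 0 R),
      t ≤ x → (isBddKernel_conj_outerKernel (R := R)).representer x t = 0 := by
  filter_upwards [isBddKernel_conj_outerKernel.representer_coeFn x] with t ht htx
  have : (t, x) ∉ triangle R := fun h => htx.not_gt h.2.1
  rw [ht, RCLike.conj_conj]
  simp [outerKernel, cutoffKernel, this]

theorem hasTrace_volterraOp_comp_volterraResolvent (z : ℂ) :
    HasTrace (volterraOp R ∘L volterraResolvent R z) 0 := by
  have : Fact ((2 : ENNReal) ≠ ⊤) := ⟨by norm_num⟩
  have hS := isCarleman_kernelOp (ν := volume.restrict (Icc 0 R))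
    (isBddKernel_conj_outerKernel (R := R))
  have hT : IsCarleman (innerOp R ∘L volterraResolvent R z) _ :=
    (isCarleman_kernelOp isBddKernel_innerKernel).comp _
  have hadj : (kernelOp (volume.restrict (Icc 0 R))
      (isBddKernel_conj_outerKernel (R := R))).adjoint = outerOp R := by
    rw [← adjoint_kernelOp isBddKernel_outerKernel isBddKernel_conj_outerKernel,
      ContinuousLinearMap.adjoint_adjoint, outerOp]
  have htrace := hS.hasTrace_adjoint_comp hT
  simp only [ContinuousLinearMap.adjoint_inner_left, inner_representer_volterraResolvent_eq_zero
    representer_conj_outerKernel_ae_eq_zero, integral_zero, hadj] at htrace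
  exact htrace

end Causality

section TestFunction

variable {R : ℝ} {ξ ζ : ℝ → ℂ}

theorem IsTestFun.eq_zero (h : IsTestFun R ξ) {r : ℝ} (hr : r ∉ Ioo 0 R) : ξ r = 0 :=
  image_eq_zero_of_notMem_tsupport fun h' => hr (h.2.2 h')

theorem IsTestFun.hasDerivAt (h : IsTestFun R ξ) (r : ℝ) : HasDerivAt ξ (deriv ξ r) r :=
  (h.1.differentiable (by simp) r).hasDerivAt

protected theorem IsTestFun.deriv (h : IsTestFun R ξ) : IsTestFun R (deriv ξ) :=
  ⟨(contDiff_infty_iff_deriv.1 h.1).2, h.2.1.deriv, tsupport_deriv_subset.trans h.2.2⟩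

theorem IsTestFun.add (h : IsTestFun R ξ) (h' : IsTestFun R ζ) : IsTestFun R (ξ + ζ) :=
  ⟨h.1.add h'.1, h.2.1.add h'.2.1, (tsupport_add ξ ζ).trans (union_subset h.2.2 h'.2.2)⟩

theorem IsTestFun.mul (h : IsTestFun R ξ) {w : ℝ → ℂ} (hw : ContDiffOn ℝ ∞ w (Ioo 0 R)) :
    IsTestFun R (w * ξ) := by
  have hsub : tsupport (w * ξ) ⊆ Ioo 0 R := (tsupport_mul_subset_right (f := w)).trans h.2.2
  exact ⟨contMDiff_iff_contDiff.1 <| contMDiff_of_tsupport fun r hr =>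
    ((hw.contDiffAt (isOpen_Ioo.mem_nhds (hsub hr))).mul h.1.contDiffAt).contMDiffAt,
    h.2.1.mul_left, hsub⟩

theorem IsTestFun.const_smul (h : IsTestFun R ξ) (c : ℂ) : IsTestFun R (c • ξ) :=
  h.mul contDiffOn_const

theorem IsTestFun.intervalIntegrable (h : IsTestFun R ξ) (a b : ℝ) :
    IntervalIntegrable ξ volume a b :=
  h.1.continuous.intervalIntegrable a b

theorem IsTestFun.integral_eq_neg (h : IsTestFun R ξ) {f : ℝ → ℂ} {s : ℝ} (hs : s ∈ Icc 0 R)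
    (hf : ∀ r ∈ Ioo 0 R, HasDerivAt ξ (f r) r) : ∫ r in s..R, f r = -ξ s := by
  have hcongr : ∫ r in s..R, f r = ∫ r in s..R, deriv ξ r := by
    refine intervalIntegral.integral_congr_uIoo fun r hr => ?_
    rw [uIoo_of_le hs.2] at hr
    exact (hf r ⟨hs.1.trans_lt hr.1, hr.2⟩).deriv.symm
  rw [hcongr, intervalIntegral.integral_deriv_eq_sub fun r _ => (h.hasDerivAt r).differentiableAt,
    h.eq_zero right_notMem_Ioo, zero_sub]
  exact h.deriv.intervalIntegrable s R

theorem IsTestFun.hasDerivAt_integral (h : IsTestFun R ξ) (r : ℝ) :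
    HasDerivAt (fun r => ∫ t in 0..r, ξ t) (ξ r) r :=
  intervalIntegral.integral_hasDerivAt_right (h.intervalIntegrable 0 r)
    (h.1.continuous.stronglyMeasurableAtFilter _ _) h.1.continuous.continuousAt

theorem IsTestFun.exists_eq_zero (h : IsTestFun R ξ) :
    ∃ ε > 0, ∃ ρ < R, (∀ r < ε, ξ r = 0) ∧ ∀ r, ρ < r → ξ r = 0 := by
  have hzero : ∀ r ∉ tsupport ξ, ξ r = 0 := fun r => image_eq_zero_of_notMem_tsupport
  rcases (tsupport ξ).eq_empty_or_nonempty with hempty | hne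
  · simp only [hempty, mem_empty_iff_false, not_false_eq_true, true_imp_iff] at hzero
    exact ⟨1, one_pos, R - 1, sub_one_lt R, fun r _ => hzero r, fun r _ => hzero r⟩
  · obtain ⟨ε, hε, hmin⟩ := h.2.1.isCompact.exists_isLeast hne
    obtain ⟨ρ, hρ, hmax⟩ := h.2.1.isCompact.exists_isGreatest hne
    exact ⟨ε, (h.2.2 hε).1, ρ, (h.2.2 hρ).2, fun r hr => hzero r fun h' => (hmin h').not_gt hr,
      fun r hr => hzero r fun h' => (hmax h').not_gt hr⟩

theorem IsTestFun.integral (h : IsTestFun R ξ) (h0 : ∫ t in 0..R, ξ t = 0) :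
    IsTestFun R fun r => ∫ t in 0..r, ξ t := by
  obtain ⟨ε, hε, ρ, hρ, hleft, hright⟩ := h.exists_eq_zero
  have hsupp : tsupport (fun r => ∫ t in 0..r, ξ t) ⊆ Icc ε ρ := by
    refine closure_minimal (fun r hr => ⟨?_, ?_⟩) isClosed_Icc <;> contrapose! hr
    · exact Function.notMem_support.2 ((intervalIntegral.integral_congr fun t ht =>
        hleft t (ht.2.trans_lt (max_lt hε hr))).trans intervalIntegral.integral_zero)
    · rw [Function.notMem_support, ← intervalIntegral.integral_add_adjacent_intervals
        (h.intervalIntegrable 0 R) (h.intervalIntegrable R r), h0, zero_add]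
      exact (intervalIntegral.integral_congr fun t ht =>
        hright t ((lt_min hρ hr).trans_le ht.1)).trans intervalIntegral.integral_zero
  refine ⟨contDiff_infty_iff_deriv.2 ⟨fun r => (h.hasDerivAt_integral r).differentiableAt, ?_⟩,
    isCompact_Icc.of_isClosed_subset (isClosed_tsupport _) hsupp,
    hsupp.trans (Icc_subset_Ioo hε hρ)⟩
  rw [funext fun r => (h.hasDerivAt_integral r).deriv]
  exact h.1

end TestFunction

section HomogeneousSolution

variable {R : ℝ} {c₁ c₂ : ℂ} {r : ℝ}

/-- The general solution `c₁ r^{1/2} + c₂ r^{1/2} log r` of `Δq = 0`. -/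
noncomputable def homogeneousFun (c₁ c₂ : ℂ) (r : ℝ) : ℂ :=
  c₁ * (√r : ℝ) + c₂ * (√r * Real.log r : ℝ)

/-- The derivative of `homogeneousFun c₁ c₂`. -/
noncomputable def homogeneousDeriv (c₁ c₂ : ℂ) (r : ℝ) : ℂ :=
  (c₁ / 2 + c₂ + c₂ / 2 * (Real.log r : ℂ)) / (√r : ℂ)

theorem ofReal_sqrt_ne_zero (hr : 0 < r) : (√r : ℂ) ≠ 0 :=
  Complex.ofReal_ne_zero.2 (Real.sqrt_ne_zero'.2 hr)

theorem ofReal_sqrt_sq (hr : 0 ≤ r) : (√r : ℂ) ^ 2 = r := by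
  exact_mod_cast Real.sq_sqrt hr

theorem hasDerivAt_ofReal_log (hr : 0 < r) :
    HasDerivAt (fun r : ℝ => (Real.log r : ℂ)) (r : ℂ)⁻¹ r := by
  simpa using (Real.hasDerivAt_log hr.ne').ofReal_comp

theorem hasDerivAt_homogeneousFun (hr : 0 < r) :
    HasDerivAt (homogeneousFun c₁ c₂) (homogeneousDeriv c₁ c₂ r) r := by
  have hs := ofReal_sqrt_ne_zero hr
  have hd := ((hasDerivAt_ofReal_sqrt hr).const_mul c₁).add
    (((hasDerivAt_ofReal_sqrt hr).mul (hasDerivAt_ofReal_log hr)).const_mul c₂)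
  refine (hd.congr_of_eventuallyEq (.of_forall fun t => ?_)).congr_deriv ?_
  · simp [homogeneousFun]
  · rw [homogeneousDeriv, ← ofReal_sqrt_sq hr.le]
    field_simp
    ring

theorem hasDerivAt_homogeneousDeriv (hr : 0 < r) :
    HasDerivAt (homogeneousDeriv c₁ c₂) (-(homogeneousFun c₁ c₂ r / (4 * (r : ℂ) ^ 2))) r := by
  have hs := ofReal_sqrt_ne_zero hr
  have hd := (((hasDerivAt_ofReal_log hr).const_mul (c₂ / 2)).const_add (c₁ / 2 + c₂)).div
    (hasDerivAt_ofReal_sqrt hr) hs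
  refine hd.congr_deriv ?_
  rw [homogeneousFun, Complex.ofReal_mul, ← ofReal_sqrt_sq hr.le]
  field_simp
  ring

theorem contDiffOn_ofReal_log : ContDiffOn ℝ ∞ (fun r : ℝ => (Real.log r : ℂ)) (Ioo 0 R) :=
  Complex.ofRealCLM.contDiff.comp_contDiffOn fun _ hr =>
    (Real.contDiffAt_log.2 hr.1.ne').contDiffWithinAt

theorem contDiffOn_ofReal_sqrt : ContDiffOn ℝ ∞ (fun r : ℝ => (√r : ℂ)) (Ioo 0 R) :=
  Complex.ofRealCLM.contDiff.comp_contDiffOn fun _ hr =>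
    (Real.contDiffAt_sqrt hr.1.ne').contDiffWithinAt

theorem contDiffOn_homogeneousFun : ContDiffOn ℝ ∞ (homogeneousFun c₁ c₂) (Ioo 0 R) := by
  simp only [funext fun r => show homogeneousFun c₁ c₂ r = c₁ * √r + c₂ * (√r * Real.log r) by
    simp [homogeneousFun]]
  exact (contDiffOn_const.mul contDiffOn_ofReal_sqrt).add
    (contDiffOn_const.mul (contDiffOn_ofReal_sqrt.mul contDiffOn_ofReal_log))

theorem contDiffOn_homogeneousDeriv : ContDiffOn ℝ ∞ (homogeneousDeriv c₁ c₂) (Ioo 0 R) :=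
  (contDiffOn_const.add (contDiffOn_const.mul contDiffOn_ofReal_log)).mul
    (contDiffOn_ofReal_sqrt.inv fun _ hr => ofReal_sqrt_ne_zero hr.1)

theorem continuous_sqrt_mul_log : Continuous fun r : ℝ => √r * Real.log r := by
  have h : (fun r : ℝ => √r * Real.log r) = fun r => 2 * (√r * Real.log √r) := by
    funext r
    rcases le_or_gt r 0 with hr | hr
    · simp [Real.sqrt_eq_zero_of_nonpos hr]
    · rw [Real.log_sqrt hr.le]
      ring
  rw [h]
  exact continuous_const.mul (Real.continuous_mul_log.comp Real.continuous_sqrt)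

theorem continuous_homogeneousFun : Continuous (homogeneousFun c₁ c₂) := by
  have := continuous_sqrt_mul_log
  unfold homogeneousFun
  fun_prop

theorem memLp_restrict_Icc_of_continuous {f : ℝ → ℂ} (hf : Continuous f) (R : ℝ) :
    MemLp f 2 (volume.restrict (Icc (0 : ℝ) R)) := by
  obtain ⟨C, hC⟩ := (isCompact_Icc (a := (0 : ℝ)) (b := R)).exists_bound_of_continuousOn
    hf.continuousOn
  refine MemLp.of_bound hf.aestronglyMeasurable C ?_
  filter_upwards [ae_restrict_mem measurableSet_Icc] with r hr using hC r hr

/-- `homogeneousFun c₁ c₂` as an element of `L²([0,R])`. -/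
noncomputable def homogeneousSol (R : ℝ) (c₁ c₂ : ℂ) : L2Interval R :=
  (memLp_restrict_Icc_of_continuous (continuous_homogeneousFun (c₁ := c₁) (c₂ := c₂)) R).toLp

theorem homogeneousSol_coeFn :
    homogeneousSol R c₁ c₂ =ᵐ[volume.restrict (Icc 0 R)] homogeneousFun c₁ c₂ :=
  MemLp.coeFn_toLp _

theorem hasBoundaryData_homogeneousSol :
    HasBoundaryData R (homogeneousSol R c₁ c₂) c₁ c₂ (homogeneousFun c₁ c₂ R) := by
  refine ⟨fun _ => 0, contDiffOn_const, isBigO_zero _ _, ?_, ?_, by simp [homogeneousFun]⟩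
  · rw [show derivWithin (fun _ => (0 : ℂ)) (Icc 0 R) = fun _ => 0 by funext; simp]
    exact isBigO_zero _ _
  · filter_upwards [homogeneousSol_coeFn] with r hr
    rw [hr, homogeneousFun, add_zero]

/- Lagrange's identity: the boundary term is the Wronskian of `ξ` and the homogeneous solution. -/
theorem IsTestFun.integral_homogeneousFun_mul_deltaExpr {ξ : ℝ → ℂ} (h : IsTestFun R ξ) {s : ℝ}
    (hs : s ∈ Icc 0 R) :
    ∫ r in s..R, homogeneousFun c₁ c₂ r * deltaExpr ξ r =
      homogeneousFun c₁ c₂ s * deriv ξ s - homogeneousDeriv c₁ c₂ s * ξ s := by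
  have hwronskian : IsTestFun R (homogeneousDeriv c₁ c₂ * ξ +
      (-1 : ℂ) • (homogeneousFun c₁ c₂ * deriv ξ)) :=
    (h.mul contDiffOn_homogeneousDeriv).add ((h.deriv.mul contDiffOn_homogeneousFun).const_smul _)
  rw [hwronskian.integral_eq_neg hs fun r hr => ?_]
  · simp only [Pi.add_apply, Pi.mul_apply, Pi.smul_apply, smul_eq_mul]
    ring
  · refine (((hasDerivAt_homogeneousDeriv hr.1).mul (h.hasDerivAt r)).add
      (((hasDerivAt_homogeneousFun hr.1).mul (h.deriv.hasDerivAt r)).const_smul _)).congr_deriv ?_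
    rw [deltaExpr, smul_eq_mul]
    ring

end HomogeneousSolution

section WeakEquation

variable {R : ℝ}

theorem isWeakDelta_iff_inner {φ f : L2Interval R} :
    IsWeakDelta R φ f ↔ ∀ (ξ : ℝ → ℂ) (h : IsTestFun R ξ),
      inner ℂ φ h.memLp_deltaExpr.toLp = inner ℂ f h.memLp.toLp := by
  have hinner : ∀ (g : ℝ → ℂ) (hg : MemLp g 2 (volume.restrict (Icc (0 : ℝ) R)))
      (u : L2Interval R), inner ℂ u hg.toLp = ∫ r in Icc (0 : ℝ) R, g r * conj (u r) := by
    intro g hg u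
    rw [L2.inner_def]
    refine integral_congr_ae ?_
    filter_upwards [hg.coeFn_toLp] with r hr
    rw [hr, RCLike.inner_apply]
  simp only [hinner]
  rfl

theorem inner_homogeneousSol_toLp (hR : 0 ≤ R) (c₁ c₂ : ℂ) {f : ℝ → ℂ}
    (hf : MemLp f 2 (volume.restrict (Icc (0 : ℝ) R))) :
    inner ℂ (homogeneousSol R c₁ c₂) hf.toLp =
      ∫ r in 0..R, homogeneousFun (conj c₁) (conj c₂) r * f r := by
  rw [intervalIntegral.integral_of_le hR, ← integral_Icc_eq_integral_Ioc, L2.inner_def]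
  refine integral_congr_ae ?_
  filter_upwards [homogeneousSol_coeFn, hf.coeFn_toLp] with r hr hfr
  rw [hr, hfr, RCLike.inner_apply, mul_comm]
  simp [homogeneousFun]

theorem isWeakDelta_homogeneousSol (hR : 0 ≤ R) (c₁ c₂ : ℂ) :
    IsWeakDelta R (homogeneousSol R c₁ c₂) 0 :=
  isWeakDelta_iff_inner.2 fun ξ h => by
    rw [inner_homogeneousSol_toLp hR, h.integral_homogeneousFun_mul_deltaExpr (left_mem_Icc.2 hR),
      h.eq_zero left_notMem_Ioo, h.deriv.eq_zero left_notMem_Ioo, inner_zero_left]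
    ring

theorem ae_mem_Ioc : ∀ᵐ s ∂volume.restrict (Icc 0 R), s ∈ Ioc 0 R := by
  rw [← restrict_Ioc_eq_restrict_Icc]
  exact ae_restrict_mem measurableSet_Ioc

theorem adjoint_outerOp_coeFn (g : L2Interval R) :
    (outerOp R).adjoint g =ᵐ[volume.restrict (Icc 0 R)] fun s => ∫ r in s..R, (√r : ℂ) * g r := by
  rw [outerOp, adjoint_kernelOp _ isBddKernel_conj_outerKernel]
  filter_upwards [kernelOp_coeFn isBddKernel_conj_outerKernel g, ae_mem_Ioc] with s hs hs'
  rw [hs]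
  simp only [outerKernel, conj_cutoffKernel, Complex.conj_ofReal, map_one]
  rw [integral_swap_triangle _ hs', one_mul]

theorem adjoint_innerOp_coeFn (g : L2Interval R) :
    (innerOp R).adjoint g =ᵐ[volume.restrict (Icc 0 R)]
      fun t => (√t : ℂ) * ∫ s in t..R, -(s : ℂ)⁻¹ * g s := by
  rw [innerOp, adjoint_kernelOp _ isBddKernel_conj_innerKernel]
  filter_upwards [kernelOp_coeFn isBddKernel_conj_innerKernel g, ae_mem_Ioc] with t ht ht'
  rw [ht]
  simp only [innerKernel, conj_cutoffKernel, Complex.conj_ofReal, map_neg, map_inv₀]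
  rw [integral_swap_triangle _ ht']

theorem integral_congr_of_ae_restrict_Icc {f g : ℝ → ℂ}
    (h : f =ᵐ[volume.restrict (Icc 0 R)] g) {a b : ℝ} (ha : a ∈ Icc 0 R) (hb : b ∈ Icc 0 R) :
    ∫ r in a..b, f r = ∫ r in a..b, g r := by
  refine intervalIntegral.integral_congr_ae ?_
  filter_upwards [(ae_restrict_iff' measurableSet_Icc).1 h] with r hr hr'
  exact hr (uIcc_subset_Icc ha hb (uIoc_subset_uIcc hr'))

theorem adjoint_outerOp_deltaExpr {ξ : ℝ → ℂ} (h : IsTestFun R ξ) :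
    (outerOp R).adjoint h.memLp_deltaExpr.toLp =ᵐ[volume.restrict (Icc 0 R)]
      fun s => √s * deriv ξ s - ξ s / (2 * √s) := by
  filter_upwards [adjoint_outerOp_coeFn h.memLp_deltaExpr.toLp, ae_mem_Ioc] with s hs hs'
  have hcongr : (fun r => (√r : ℂ) * (h.memLp_deltaExpr.toLp : L2Interval R) r)
      =ᵐ[volume.restrict (Icc 0 R)] fun r => homogeneousFun 1 0 r * deltaExpr ξ r := by
    filter_upwards [h.memLp_deltaExpr.coeFn_toLp] with r hr
    simp [hr, homogeneousFun]
  rw [hs, integral_congr_of_ae_restrict_Icc hcongr (Ioc_subset_Icc_self hs')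
      (right_mem_Icc.2 (hs'.1.le.trans hs'.2)),
    h.integral_homogeneousFun_mul_deltaExpr (Ioc_subset_Icc_self hs'), homogeneousFun,
    homogeneousDeriv]
  ring

theorem adjoint_volterraOp_deltaExpr {ξ : ℝ → ℂ} (h : IsTestFun R ξ) :
    (volterraOp R).adjoint h.memLp_deltaExpr.toLp = h.memLp.toLp := by
  rw [volterraOp, ContinuousLinearMap.adjoint_comp, ContinuousLinearMap.comp_apply]
  refine Lp.ext ?_
  filter_upwards [adjoint_innerOp_coeFn ((outerOp R).adjoint h.memLp_deltaExpr.toLp), ae_mem_Ioc,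
    h.memLp.coeFn_toLp] with t ht ht' hξ
  have hquot : IsTestFun R ((fun s : ℝ => -(√s : ℂ)⁻¹) * ξ) :=
    h.mul (contDiffOn_ofReal_sqrt.inv fun s hs => ofReal_sqrt_ne_zero hs.1).neg
  have hcongr : (fun s : ℝ => -(s : ℂ)⁻¹ * (outerOp R).adjoint h.memLp_deltaExpr.toLp s)
      =ᵐ[volume.restrict (Icc 0 R)]
        fun s : ℝ => -(s : ℂ)⁻¹ * (√s * deriv ξ s - ξ s / (2 * √s)) := by
    filter_upwards [adjoint_outerOp_deltaExpr h] with s hs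
    rw [hs]
  rw [ht, hξ, integral_congr_of_ae_restrict_Icc hcongr (Ioc_subset_Icc_self ht')
      (right_mem_Icc.2 (ht'.1.le.trans ht'.2)),
    hquot.integral_eq_neg (Ioc_subset_Icc_self ht') fun s hs => ?_]
  · have := ofReal_sqrt_ne_zero ht'.1
    simp only [Pi.mul_apply]
    field_simp
  · have hs0 := ofReal_sqrt_ne_zero hs.1
    refine (((hasDerivAt_ofReal_sqrt hs.1).inv hs0).neg.mul (h.hasDerivAt s)).congr_deriv ?_
    rw [← ofReal_sqrt_sq hs.1.le]
    simp only [Pi.neg_apply, Pi.inv_apply]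
    field_simp
    ring

theorem isWeakDelta_volterraOp (g : L2Interval R) : IsWeakDelta R (volterraOp R g) g :=
  isWeakDelta_iff_inner.2 fun _ h => by
    rw [← ContinuousLinearMap.adjoint_inner_right, adjoint_volterraOp_deltaExpr h]

end WeakEquation

section WeakKernel

variable {R : ℝ} {ξ ζ : ℝ → ℂ}

theorem contDiffOn_ofReal_inv : ContDiffOn ℝ ∞ (fun r : ℝ => (r : ℂ)⁻¹) (Ioo 0 R) :=
  Complex.ofRealCLM.contDiff.contDiffOn.inv fun _ hr => Complex.ofReal_ne_zero.2 hr.1.ne'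

/- Integration by parts: `P log` is a test function with derivative `P/s + P' log s`. -/
theorem IsTestFun.integral_inv_mul {P : ℝ → ℂ} (h : IsTestFun R P) (hR : 0 ≤ R) :
    ∫ s in 0..R, (s : ℂ)⁻¹ * P s = -∫ s in 0..R, (Real.log s : ℂ) * deriv P s := by
  have hint := (h.mul contDiffOn_ofReal_log).integral_eq_neg (left_mem_Icc.2 hR)
    fun s hs => (hasDerivAt_ofReal_log hs.1).mul (h.hasDerivAt s)
  have hadd := intervalIntegral.integral_add
    ((h.mul contDiffOn_ofReal_inv).intervalIntegrable 0 R)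
    ((h.deriv.mul contDiffOn_ofReal_log).intervalIntegrable 0 R)
  exact eq_neg_of_add_eq_zero_left (hadd.symm.trans (hint.trans (by simp)))

theorem deltaExpr_neg_sqrt_mul {P Q : ℝ → ℂ} {r : ℝ} (hr : 0 < r)
    (hQ : ∀ s : ℝ, 0 < s → HasDerivAt Q ((s : ℂ)⁻¹ * P s) s)
    (hP : ∀ s : ℝ, 0 < s → HasDerivAt P (√s * ζ s) s) :
    deltaExpr (fun s => -(√s : ℂ) * Q s) r = ζ r := by
  have hderiv : ∀ s : ℝ, 0 < s →
      HasDerivAt (fun s : ℝ => -(√s : ℂ) * Q s) (-(Q s / 2 + P s) / √s) s := fun s hs => by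
    refine ((hasDerivAt_ofReal_sqrt hs).neg.mul (hQ s hs)).congr_deriv ?_
    have hs0 := ofReal_sqrt_ne_zero hs
    rw [← ofReal_sqrt_sq hs.le]
    simp only [Pi.neg_apply]
    field_simp
    ring
  have heq : deriv (fun s : ℝ => -(√s : ℂ) * Q s) =ᶠ[𝓝 r] fun s => -(Q s / 2 + P s) / √s := by
    filter_upwards [Ioi_mem_nhds hr] with s hs using (hderiv s hs).deriv
  have hr0 := ofReal_sqrt_ne_zero hr
  have hderiv₂ := ((((hQ r hr).div_const 2).add (hP r hr)).neg.div (hasDerivAt_ofReal_sqrt hr) hr0)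
  rw [deltaExpr, (hderiv₂.congr_of_eventuallyEq heq).deriv, ← ofReal_sqrt_sq hr.le]
  simp only [Pi.neg_apply, Pi.add_apply]
  field_simp
  ring

theorem IsTestFun.exists_deltaExpr_eq (h : IsTestFun R ζ) (hR : 0 ≤ R)
    (h₁ : ∫ r in 0..R, homogeneousFun 1 0 r * ζ r = 0)
    (h₂ : ∫ r in 0..R, homogeneousFun 0 1 r * ζ r = 0) :
    ∃ ξ, IsTestFun R ξ ∧ ∀ r, 0 < r → deltaExpr ξ r = ζ r := by
  simp only [homogeneousFun, one_mul, zero_mul, add_zero, zero_add] at h₁ h₂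
  have hsqrt := h.mul contDiffOn_ofReal_sqrt
  have hP := hsqrt.integral h₁
  have hinv := hP.mul contDiffOn_ofReal_inv
  have hQ := hinv.integral <| (hP.integral_inv_mul hR).trans <| by
    refine neg_eq_zero.2 (.trans (intervalIntegral.integral_congr fun r _ => ?_) h₂)
    rw [(hsqrt.hasDerivAt_integral r).deriv, Pi.mul_apply, Complex.ofReal_mul]
    ring
  exact ⟨_, hQ.mul contDiffOn_ofReal_sqrt.neg, fun r hr => deltaExpr_neg_sqrt_mul hr
    (fun s _ => hinv.hasDerivAt_integral s) fun s _ => hsqrt.hasDerivAt_integral s⟩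

/-- The space of test functions `C_c^∞((0,R))`. -/
def testFunSpace (R : ℝ) : Submodule ℂ (ℝ → ℂ) where
  carrier := {ξ | IsTestFun R ξ}
  zero_mem' := ⟨contDiff_const, HasCompactSupport.zero, by simp⟩
  add_mem' := IsTestFun.add
  smul_mem' := fun c _ h => h.const_smul c

/-- The inclusion of the test functions into `L²([0,R])`. -/
noncomputable def testFunToLp (R : ℝ) : testFunSpace R →ₗ[ℂ] L2Interval R where
  toFun ξ := (IsTestFun.memLp ξ.2).toLp
  map_add' ξ ζ := MemLp.toLp_add (IsTestFun.memLp ξ.2) (IsTestFun.memLp ζ.2)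
  map_smul' c ξ := MemLp.toLp_const_smul c (IsTestFun.memLp ξ.2)

theorem homogeneousSol_eq_smul_add_smul (c₁ c₂ : ℂ) :
    homogeneousSol R c₁ c₂ = c₁ • homogeneousSol R 1 0 + c₂ • homogeneousSol R 0 1 := by
  simp only [homogeneousSol, ← MemLp.toLp_const_smul, ← MemLp.toLp_add]
  congr 1
  funext r
  simp [homogeneousFun]

theorem IsWeakDelta.inner_testFun_eq_zero (hR : 0 ≤ R) {φ : L2Interval R}
    (hφ : IsWeakDelta R φ 0) (h : IsTestFun R ζ)
    (h₁ : inner ℂ (homogeneousSol R 1 0) h.memLp.toLp = 0)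
    (h₂ : inner ℂ (homogeneousSol R 0 1) h.memLp.toLp = 0) :
    inner ℂ φ h.memLp.toLp = 0 := by
  simp only [inner_homogeneousSol_toLp hR, map_one, map_zero] at h₁ h₂
  obtain ⟨ξ, hξ, heq⟩ := h.exists_deltaExpr_eq hR h₁ h₂
  have htoLp : h.memLp.toLp = hξ.memLp_deltaExpr.toLp := by
    refine (MemLp.toLp_eq_toLp_iff _ _).2 ?_
    filter_upwards [ae_mem_Ioc] with r hr using (heq r hr.1).symm
  rw [htoLp, isWeakDelta_iff_inner.1 hφ ξ hξ, inner_zero_left]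

theorem IsWeakDelta.exists_eq_homogeneousSol (hR : 0 ≤ R) {φ : L2Interval R}
    (hφ : IsWeakDelta R φ 0) : ∃ c₁ c₂, φ = homogeneousSol R c₁ c₂ := by
  let moment (u : L2Interval R) : testFunSpace R →ₗ[ℂ] ℂ :=
    (innerSL ℂ u).toLinearMap ∘ₗ testFunToLp R
  have hker : ⨅ i, (moment (![homogeneousSol R 1 0, homogeneousSol R 0 1] i)).ker ≤
      (moment φ).ker := by
    intro ζ hζ
    simp only [Submodule.mem_iInf, Fin.forall_fin_two] at hζ
    exact hφ.inner_testFun_eq_zero hR ζ.2 hζ.1 hζ.2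
  obtain ⟨c, hc⟩ := (Submodule.mem_span_range_iff_exists_fun ℂ).1 (mem_span_of_iInf_ker_le_ker hker)
  refine ⟨conj (c 0), conj (c 1), sub_eq_zero.1 <| deltaMaxGraph_single_valued R (0, _)
    (isWeakDelta_iff_inner.2 fun ζ h => ?_) rfl⟩
  have hζ := LinearMap.congr_fun hc ⟨ζ, h⟩
  rw [inner_zero_left, inner_sub_left, homogeneousSol_eq_smul_add_smul, inner_add_left,
    inner_smul_left, inner_smul_left, RCLike.conj_conj, RCLike.conj_conj]
  simp only [Fin.sum_univ_two] at hζ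
  exact (sub_eq_zero.2 hζ.symm).symm

theorem IsWeakDelta.exists_eq_homogeneousSol_add (hR : 0 ≤ R) {φ f : L2Interval R}
    (hφ : IsWeakDelta R φ f) : ∃ c₁ c₂, φ = homogeneousSol R c₁ c₂ + volterraOp R f := by
  have hsub : (φ, f) - (volterraOp R f, f) ∈ deltaMaxGraph R :=
    sub_mem hφ (isWeakDelta_volterraOp f)
  rw [Prod.mk_sub_mk, sub_self] at hsub
  obtain ⟨c₁, c₂, h⟩ := IsWeakDelta.exists_eq_homogeneousSol hR hsub
  exact ⟨c₁, c₂, sub_eq_iff_eq_add.1 h⟩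

end WeakKernel

section BoundaryData

variable {R : ℝ} {c₁ c₂ b c₁' c₂' b' : ℂ} {φ : L2Interval R}

theorem eq_zero_of_tendsto_add_mul_log
    (h : Tendsto (fun r : ℝ => c₁ + c₂ * (Real.log r : ℂ)) (𝓝[>] 0) (𝓝 0)) :
    c₁ = 0 ∧ c₂ = 0 := by
  have hlog : Tendsto (fun r : ℝ => (Real.log r : ℂ)⁻¹) (𝓝[>] 0) (𝓝 0) := by
    simpa [Function.comp_def] using
      (tendsto_inv_atBot_zero.comp Real.tendsto_log_nhdsGT_zero).ofReal
  have heq : (fun r : ℝ => (c₁ + c₂ * (Real.log r : ℂ)) * (Real.log r : ℂ)⁻¹) =ᶠ[𝓝[>] 0]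
      fun r : ℝ => c₁ * (Real.log r : ℂ)⁻¹ + c₂ := by
    filter_upwards [Ioo_mem_nhdsGT one_pos] with r hr
    have : (Real.log r : ℂ) ≠ 0 := by exact_mod_cast (Real.log_neg hr.1 hr.2).ne
    field_simp
  have hc₂ : c₂ = 0 := by
    simpa using tendsto_nhds_unique ((hlog.const_mul c₁).add_const c₂)
      ((h.mul hlog).congr' heq)
  subst hc₂
  simp only [zero_mul, add_zero] at h
  exact ⟨tendsto_nhds_unique tendsto_const_nhds h, rfl⟩

theorem eq_zero_of_homogeneousFun_isBigO
    (h : homogeneousFun c₁ c₂ =O[𝓝[>] 0] fun r : ℝ => r ^ (3 / 2 : ℝ)) : c₁ = 0 ∧ c₂ = 0 := by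
  have hinv : (fun r : ℝ => (√r : ℂ)⁻¹) =O[𝓝[>] 0] fun r : ℝ => (√r)⁻¹ :=
    .of_bound 1 (.of_forall fun r => by rw [one_mul, norm_inv, norm_inv, Complex.norm_real])
  have hO : (fun r : ℝ => c₁ + c₂ * (Real.log r : ℂ)) =O[𝓝[>] 0] fun r : ℝ => r := by
    refine (h.mul hinv).congr' ?_ ?_ <;> filter_upwards [self_mem_nhdsWithin] with r (hr : 0 < r)
    · have := ofReal_sqrt_ne_zero hr
      rw [homogeneousFun, Complex.ofReal_mul]
      field_simp
    · rw [show (3 / 2 : ℝ) = 1 + 1 / 2 by norm_num, Real.rpow_add hr, Real.rpow_one,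
        ← Real.sqrt_eq_rpow, mul_inv_cancel_right₀ (Real.sqrt_pos.2 hr).ne']
  exact eq_zero_of_tendsto_add_mul_log (hO.trans_tendsto (tendsto_id.mono_left nhdsWithin_le_nhds))

theorem HasBoundaryData.eq_zero (hR : 0 < R) (h : HasBoundaryData R 0 c₁ c₂ b) :
    c₁ = 0 ∧ c₂ = 0 ∧ b = 0 := by
  obtain ⟨ψ, hψ, hO, -, hae, rfl⟩ := h
  have hzero : EqOn (fun r => homogeneousFun c₁ c₂ r + ψ r) (fun _ => 0) (Icc 0 R) := by
    refine Measure.eqOn_Icc_of_ae_eq volume hR.ne ?_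
      (continuous_homogeneousFun.continuousOn.add hψ.continuousOn) continuousOn_const
    filter_upwards [hae, Lp.coeFn_zero ℂ 2 (volume.restrict (Icc (0 : ℝ) R))] with r hr hr'
    exact hr.symm.trans hr'
  have hneg : (fun r => -ψ r) =ᶠ[𝓝[>] 0] homogeneousFun c₁ c₂ := by
    filter_upwards [Ioo_mem_nhdsGT hR] with r hr
    exact (eq_neg_of_add_eq_zero_left (hzero (Ioo_subset_Icc_self hr))).symm
  obtain ⟨hc₁, hc₂⟩ := eq_zero_of_homogeneousFun_isBigO (hO.neg_left.congr' hneg .rfl)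
  exact ⟨hc₁, hc₂, hzero (right_mem_Icc.2 hR.le)⟩

theorem HasBoundaryData.unique (hR : 0 < R) (h : HasBoundaryData R φ c₁ c₂ b)
    (h' : HasBoundaryData R φ c₁' c₂' b') : c₁ = c₁' ∧ c₂ = c₂' ∧ b = b' := by
  have hsub := h.add hR (h'.smul (-1))
  simp only [neg_one_smul, add_neg_cancel, neg_one_mul] at hsub
  simpa only [add_neg_eq_zero] using hsub.eq_zero hR

end BoundaryData

section LogMode

variable {R : ℝ}

/-- The coefficient of `zⁿ` in the solution of `Δu = zu` that behaves like `r^{1/2} (log r - a)` as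
`r → 0`. -/
noncomputable def logMode (a : ℝ) (n : ℕ) (r : ℝ) : ℝ :=
  (-1 / 4) ^ n / (n.factorial : ℝ) ^ 2 * (r ^ 2) ^ n * (√r * (Real.log r - a - (harmonic n : ℝ)))

theorem ofReal_logMode_zero (a r : ℝ) : (logMode a 0 r : ℂ) = homogeneousFun (-a) 1 r := by
  simp [logMode, homogeneousFun]
  ring

theorem continuous_logMode (a : ℝ) (n : ℕ) : Continuous (logMode a n) := by
  have h : logMode a n = fun r => (-1 / 4) ^ n / (n.factorial : ℝ) ^ 2 * (r ^ 2) ^ n *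
      (√r * Real.log r - √r * (a + (harmonic n : ℝ))) := by
    funext r
    rw [logMode]
    ring
  rw [h]
  have := continuous_sqrt_mul_log
  fun_prop

/-- `logMode a n` as an element of `L²([0,R])`. -/
noncomputable def logModeLp (R a : ℝ) (n : ℕ) : L2Interval R :=
  (memLp_restrict_Icc_of_continuous
    (Complex.continuous_ofReal.comp (continuous_logMode a n)) R).toLp

theorem logModeLp_coeFn (a : ℝ) (n : ℕ) :
    logModeLp R a n =ᵐ[volume.restrict (Icc 0 R)] fun r => (logMode a n r : ℂ) :=
  MemLp.coeFn_toLp _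

theorem logModeLp_zero (a : ℝ) : logModeLp R a 0 = homogeneousSol R (-a) 1 := by
  refine Lp.ext ?_
  filter_upwards [logModeLp_coeFn a 0, homogeneousSol_coeFn] with r h₁ h₂
  rw [h₁, h₂, ofReal_logMode_zero]

theorem continuous_pow_mul_log_sub (k : ℕ) (d : ℝ) :
    Continuous fun t : ℝ => t ^ (k + 1) * (Real.log t - d) := by
  have h : (fun t : ℝ => t ^ (k + 1) * (Real.log t - d)) =
      fun t => t ^ k * (t * Real.log t) - d * t ^ (k + 1) := by
    funext t
    ring
  rw [h]
  have := Real.continuous_mul_log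
  fun_prop

theorem integral_pow_mul_log_sub (k : ℕ) (d : ℝ) {s : ℝ} (hs : 0 ≤ s) :
    ∫ t in 0..s, t ^ (k + 1) * (Real.log t - d) =
      s ^ (k + 2) / (k + 2) * (Real.log s - (d + 1 / (k + 2))) := by
  have hcont : Continuous fun s : ℝ => s ^ (k + 2) / (k + 2) * (Real.log s - (d + 1 / (k + 2))) :=
    ((continuous_pow_mul_log_sub (k + 1) (d + 1 / (k + 2))).div_const ((k : ℝ) + 2)).congr
      fun s => by ring
  rw [intervalIntegral.integral_eq_sub_of_hasDerivAt_of_le hs hcont.continuousOn (fun t ht => ?_)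
    ((continuous_pow_mul_log_sub k d).intervalIntegrable _ _)]
  · simp
  · refine (((hasDerivAt_pow (k + 2) t).div_const ((k : ℝ) + 2)).mul
      ((Real.hasDerivAt_log ht.1.ne').sub_const (d + 1 / (k + 2)))).congr_deriv ?_
    have := ht.1.ne'
    push_cast
    field_simp
    ring

theorem innerPrimitive_logModeLp (a : ℝ) (n : ℕ) {s : ℝ} (hs : s ∈ Icc 0 R) :
    innerPrimitive (logModeLp R a n) s = ((-1 / 4) ^ n / (n.factorial : ℝ) ^ 2 *
      (s ^ (2 * n + 2) / (2 * n + 2) *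
        (Real.log s - (a + (harmonic n : ℝ) + 1 / (2 * n + 2)))) : ℝ) := by
  have hcongr : (fun t : ℝ => (√t : ℂ) * logModeLp R a n t) =ᵐ[volume.restrict (Icc 0 R)]
      fun t => (((-1 / 4) ^ n / (n.factorial : ℝ) ^ 2 *
        (t ^ (2 * n + 1) * (Real.log t - (a + (harmonic n : ℝ)))) : ℝ) : ℂ) := by
    filter_upwards [logModeLp_coeFn a n, ae_mem_Ioc] with t ht ht'
    rw [ht, ← Complex.ofReal_mul, logMode]
    congr 1
    linear_combination (-1 / 4) ^ n / (n.factorial : ℝ) ^ 2 * (t ^ 2) ^ n *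
      (Real.log t - a - (harmonic n : ℝ)) * Real.mul_self_sqrt ht'.1.le
  rw [innerPrimitive_eq _ hs, integral_congr_of_ae_restrict_Icc hcongr
      (left_mem_Icc.2 (hs.1.trans hs.2)) hs, intervalIntegral.integral_ofReal,
    intervalIntegral.integral_const_mul, integral_pow_mul_log_sub _ _ hs.1]
  push_cast
  rfl

theorem volterraFun_logModeLp (a : ℝ) (n : ℕ) {r : ℝ} (hr : r ∈ Icc 0 R) :
    volterraFun (logModeLp R a n) r = logMode a (n + 1) r := by
  have hcongr : outerPrimitive (logModeLp R a n) r =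
      ∫ s in 0..r, (((-1 / 4) ^ n / (n.factorial : ℝ) ^ 2 / (2 * n + 2) *
        (s ^ (2 * n + 1) *
          (Real.log s - (a + (harmonic n : ℝ) + 1 / (2 * n + 2)))) : ℝ) : ℂ) := by
    refine intervalIntegral.integral_congr_ae (Eventually.of_forall fun s hs => ?_)
    rw [uIoc_of_le hr.1] at hs
    rw [innerPrimitive_logModeLp a n ⟨hs.1.le, hs.2.trans hr.2⟩, ← Complex.ofReal_inv,
      ← Complex.ofReal_mul]
    congr 1
    have := hs.1.ne'
    field_simp
    ring
  rw [volterraFun, hcongr, intervalIntegral.integral_ofReal, intervalIntegral.integral_const_mul,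
    integral_pow_mul_log_sub _ _ hr.1, ← Complex.ofReal_mul, ← Complex.ofReal_neg]
  congr 1
  rw [logMode, harmonic_succ, Nat.factorial_succ]
  push_cast
  field_simp
  ring

theorem volterraOp_logModeLp (a : ℝ) (n : ℕ) :
    volterraOp R (logModeLp R a n) = logModeLp R a (n + 1) := by
  refine Lp.ext ?_
  filter_upwards [volterraOp_coeFn (logModeLp R a n), logModeLp_coeFn a (n + 1),
    ae_restrict_mem measurableSet_Icc] with r h₁ h₂ hr
  rw [h₁, h₂, volterraFun_logModeLp a n hr]

theorem volterraOp_pow_homogeneousSol (a : ℝ) (n : ℕ) :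
    (volterraOp R ^ n) (homogeneousSol R (-a) 1) = logModeLp R a n := by
  induction n with
  | zero => rw [pow_zero, one_apply_eq_self, logModeLp_zero]
  | succ n ih => rw [pow_succ', mul_apply_eq_comp, ih, volterraOp_logModeLp]

/-- The solution of `Δu = zu` that behaves like `r^{1/2} (log r - a)` as `r → 0`. For `a = tan θ`
it satisfies the boundary condition of `Δ_θ` at `0`. -/
noncomputable def logSolution (R a : ℝ) (z : ℂ) : L2Interval R :=
  volterraResolvent R z (homogeneousSol R (-a) 1)

/-- The value at `R` of `logSolution R a z`. -/
noncomputable def logSolutionEndpoint (R a : ℝ) (z : ℂ) : ℂ :=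
  homogeneousFun (-a) 1 R + z * endpointEval R (logSolution R a z)

theorem hasSum_logSolutionEndpoint (hR : 0 ≤ R) (a : ℝ) (z : ℂ) :
    HasSum (fun n : ℕ => z ^ n * (logMode a n R : ℂ)) (logSolutionEndpoint R a z) := by
  have hmode : ∀ n, endpointEval R (logModeLp R a n) = logMode a (n + 1) R := fun n => by
    rw [endpointEval_apply _ hR, volterraFun_logModeLp a n (right_mem_Icc.2 hR)]
  have hsum := ((hasSum_volterraResolvent_apply z (homogeneousSol R (-a) 1)).mapL
    (endpointEval R)).mul_left z
  simp only [map_smul, volterraOp_pow_homogeneousSol, hmode] at hsum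
  rw [← hasSum_nat_add_iff' 1]
  simp only [Finset.range_one, Finset.sum_singleton, pow_zero, one_mul, ofReal_logMode_zero,
    logSolutionEndpoint, add_sub_cancel_left]
  refine hsum.congr_fun fun n => ?_
  rw [smul_eq_mul, pow_succ']
  ring

theorem hasDerivAt_logSolutionEndpoint (a : ℝ) (z : ℂ) :
    HasDerivAt (logSolutionEndpoint R a)
      (endpointEval R (volterraResolvent R z (logSolution R a z))) z := by
  have hsol : HasDerivAt (logSolution R a)
      (volterraResolvent R z (volterraOp R (logSolution R a z))) z :=
    ((hasDerivAt_volterraResolvent z).clm_apply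
      (hasDerivAt_const z (homogeneousSol R (-a) 1))).congr_deriv (by simp [logSolution])
  refine (((hasDerivAt_id z).mul ((endpointEval R).hasFDerivAt.comp_hasDerivAt z hsol)).const_add
    (homogeneousFun (-a) 1 R)).congr_deriv ?_
  have hresolvent : volterraResolvent R z (logSolution R a z) =
      logSolution R a z + z • volterraResolvent R z (volterraOp R (logSolution R a z)) := by
    conv_lhs => rw [logSolution, volterraResolvent_apply z (homogeneousSol R (-a) 1), map_add,
      map_smul, map_smul]
    rfl
  rw [hresolvent, map_add, map_smul]
  simp

theorem summable_besselJZero (w : ℂ) :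
    Summable fun k : ℕ => w ^ k / ((k.factorial : ℂ) ^ 2) := by
  refine Summable.of_norm_bounded (Real.summable_pow_div_factorial ‖w‖) fun k => ?_
  rw [norm_div, norm_pow, norm_pow, Complex.norm_natCast]
  have hk : (1 : ℝ) ≤ k.factorial := mod_cast k.factorial_pos
  exact div_le_div_of_nonneg_left (by positivity) (by positivity) (le_self_pow₀ hk two_ne_zero)

theorem charF_eq (hR : 0 < R) (θ : ℝ) {μ : ℂ} (hμ : μ ≠ 0) :
    charF R θ μ = 2 / (Real.pi : ℂ) / √R * logSolutionEndpoint R (Real.tan θ) (μ ^ 2) := by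
  have hJ := (summable_besselJZero (-((μ * R) ^ 2) / 4)).hasSum
  have hB := hasSum_logSolutionEndpoint hR.le (Real.tan θ) (μ ^ 2)
  have hsqrt := ofReal_sqrt_ne_zero hR
  have hY : HasSum (fun k : ℕ => ((harmonic k : ℚ) : ℂ) * (-((μ * R) ^ 2) / 4) ^ k /
      ((k.factorial : ℂ) ^ 2))
      ((Real.log R - Real.tan θ : ℝ) * besselJZero (μ * R) -
        logSolutionEndpoint R (Real.tan θ) (μ ^ 2) / √R) := by
    refine ((hJ.mul_left ((Real.log R - Real.tan θ : ℝ) : ℂ)).sub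
      (hB.div_const (√R : ℂ))).congr_fun fun k => ?_
    have hpow : (-((μ * R) ^ 2) / 4) ^ k = (-1 / 4) ^ k * ((R : ℂ) ^ 2) ^ k * (μ ^ 2) ^ k := by
      rw [← mul_pow, ← mul_pow]
      congr 1
      ring
    have hk : (k.factorial : ℂ) ≠ 0 := mod_cast k.factorial_ne_zero
    rw [hpow, logMode]
    push_cast
    field_simp
    ring
  rw [charF, besselYZero, hY.tsum_eq, kappaConst, Complex.log_mul_ofReal R hR μ hμ]
  push_cast
  field_simp
  ring

end LogMode

section Resolvent

variable {R θ a : ℝ} {z c₁ c₂ b : ℂ}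

theorem IsWeakDelta.add {φ f φ' f' : L2Interval R} (h : IsWeakDelta R φ f)
    (h' : IsWeakDelta R φ' f') : IsWeakDelta R (φ + φ') (f + f') :=
  (deltaMaxGraph R).add_mem (x := (φ, f)) (y := (φ', f')) h h'

theorem IsWeakDelta.sub {φ f φ' f' : L2Interval R} (h : IsWeakDelta R φ f)
    (h' : IsWeakDelta R φ' f') : IsWeakDelta R (φ - φ') (f - f') :=
  (deltaMaxGraph R).sub_mem (x := (φ, f)) (y := (φ', f')) h h'

theorem IsWeakDelta.smul {φ f : L2Interval R} (c : ℂ) (h : IsWeakDelta R φ f) :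
    IsWeakDelta R (c • φ) (c • f) :=
  (deltaMaxGraph R).smul_mem (x := (φ, f)) c h

theorem exists_deltaTheta_eq (hR : 0 < R) {u f : L2Interval R} (h : IsWeakDelta R u f)
    (hu : u ∈ boundarySpace R hR θ) :
    ∃ x : (deltaTheta R hR θ).domain, (x : L2Interval R) = u ∧ deltaTheta R hR θ x = f := by
  have hgraph : (u, f) ∈ (deltaMax R).graph := by rwa [deltaMax_graph]
  obtain ⟨y, rfl, rfl⟩ := (LinearPMap.mem_graph_iff _).1 hgraph
  exact ⟨⟨y, hu, y.2⟩, rfl, LinearPMap.domRestrict_apply rfl⟩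

theorem isWeakDelta_deltaTheta (hR : 0 < R) (x : (deltaTheta R hR θ).domain) :
    IsWeakDelta R x (deltaTheta R hR θ x) := by
  have hgraph := (deltaMax R).mem_graph ⟨x, x.2.2⟩
  rwa [deltaMax_graph] at hgraph

theorem isWeakDelta_logSolution (hR : 0 ≤ R) (a : ℝ) (z : ℂ) :
    IsWeakDelta R (logSolution R a z) (z • logSolution R a z) := by
  have h := (isWeakDelta_homogeneousSol hR (-a) 1).add
    (isWeakDelta_volterraOp (z • logSolution R a z))
  rwa [logSolution, ← volterraResolvent_apply, zero_add] at h

theorem hasBoundaryData_logSolution (hR : 0 < R) (a : ℝ) (z : ℂ) :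
    HasBoundaryData R (logSolution R a z) (-a) 1 (logSolutionEndpoint R a z) := by
  have h := (hasBoundaryData_homogeneousSol (R := R) (c₁ := -a) (c₂ := 1)).add hR
    (hasBoundaryData_volterraOp (z • logSolution R a z) hR)
  rwa [logSolution, ← volterraResolvent_apply, add_zero, add_zero, map_smul] at h

theorem logSolution_ne_zero (hR : 0 < R) (a : ℝ) (z : ℂ) : logSolution R a z ≠ 0 := by
  intro h
  have hdata := hasBoundaryData_logSolution hR a z
  rw [h] at hdata
  exact one_ne_zero (hdata.eq_zero hR).2.1

theorem IsWeakDelta.eq_volterraResolvent (hR : 0 < R) {u : L2Interval R}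
    (hu : IsWeakDelta R u (z • u)) (hdata : HasBoundaryData R u c₁ c₂ b) :
    u = volterraResolvent R z (homogeneousSol R c₁ c₂) := by
  obtain ⟨d₁, d₂, hd⟩ := hu.exists_eq_homogeneousSol_add hR.le
  have hdata' := (hasBoundaryData_homogeneousSol (R := R) (c₁ := d₁) (c₂ := d₂)).add hR
    (hasBoundaryData_volterraOp (z • u) hR)
  rw [← hd, add_zero, add_zero] at hdata'
  obtain ⟨rfl, rfl, -⟩ := hdata.unique hR hdata'
  rw [← sub_eq_iff_eq_add.2 hd, volterraResolvent_sub_volterraOp]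

theorem cos_mul_add_sin_mul_eq_zero_iff (hθ : Real.cos θ ≠ 0) :
    (Real.cos θ : ℂ) * c₁ + (Real.sin θ : ℂ) * c₂ = 0 ↔ c₁ = c₂ * -(Real.tan θ : ℂ) := by
  have hcos : (Real.cos θ : ℂ) ≠ 0 := mod_cast hθ
  have htan : (Real.tan θ : ℂ) * Real.cos θ = Real.sin θ := mod_cast Real.tan_mul_cos hθ
  have hfactor : (Real.cos θ : ℂ) * c₁ + (Real.sin θ : ℂ) * c₂ =
      Real.cos θ * (c₁ - c₂ * -(Real.tan θ : ℂ)) := by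
    rw [← htan]
    ring
  rw [hfactor, mul_eq_zero, or_iff_right hcos, sub_eq_zero]

theorem homogeneousSol_mul_neg (a : ℝ) (c : ℂ) :
    homogeneousSol R (c * -a) c = c • homogeneousSol R (-a) 1 := by
  rw [homogeneousSol_eq_smul_add_smul, homogeneousSol_eq_smul_add_smul (-(a : ℂ)), smul_add,
    smul_smul, smul_smul, mul_one]

theorem eq_zero_of_isWeakDelta_smul (hR : 0 < R) (hθ : Real.cos θ ≠ 0)
    (hz : logSolutionEndpoint R (Real.tan θ) z ≠ 0) {u : L2Interval R}
    (hu : IsWeakDelta R u (z • u)) (hb : u ∈ boundarySpace R hR θ) : u = 0 := by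
  obtain ⟨c₁, c₂, hdata, hc⟩ := hb
  rw [cos_mul_add_sin_mul_eq_zero_iff hθ] at hc
  have hsol : u = c₂ • logSolution R (Real.tan θ) z := by
    rw [hu.eq_volterraResolvent hR hdata, hc, homogeneousSol_mul_neg, map_smul, logSolution]
  have hdata' := (hasBoundaryData_logSolution hR (Real.tan θ) z).smul c₂
  rw [← hsol] at hdata'
  have hc₂ : c₂ = 0 := (mul_eq_zero.1 (hdata.unique hR hdata').2.2.symm).resolve_right hz
  rw [hsol, hc₂, zero_smul]

/-- The resolvent `(Δ_θ - z)⁻¹` for `a = tan θ`. The first summand solves `Δu - zu = y` with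
vanishing data at `0`; the multiple of `logSolution R a z` then makes the value at `R` vanish. -/
noncomputable def thetaResolvent (R a : ℝ) (z : ℂ) : L2Interval R →L[ℂ] L2Interval R :=
  volterraOp R ∘L volterraResolvent R z +
    (endpointEval R ∘L volterraResolvent R z).smulRight
      (-(logSolutionEndpoint R a z)⁻¹ • logSolution R a z)

theorem thetaResolvent_apply (a : ℝ) (z : ℂ) (y : L2Interval R) :
    thetaResolvent R a z y = volterraOp R (volterraResolvent R z y) +
      (endpointEval R (volterraResolvent R z y) * -(logSolutionEndpoint R a z)⁻¹) •
        logSolution R a z := by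
  rw [← smul_smul]
  rfl

theorem isWeakDelta_thetaResolvent (hR : 0 ≤ R) (a : ℝ) (z : ℂ) (y : L2Interval R) :
    IsWeakDelta R (thetaResolvent R a z y) (y + z • thetaResolvent R a z y) := by
  rw [thetaResolvent_apply]
  set c := endpointEval R (volterraResolvent R z y) * -(logSolutionEndpoint R a z)⁻¹
  have h := (isWeakDelta_volterraOp (volterraResolvent R z y)).add
    ((isWeakDelta_logSolution hR a z).smul c)
  rw [smul_add, smul_comm z c, ← add_assoc, ← map_smul, ← volterraResolvent_apply]
  exact h

theorem thetaResolvent_mem_boundarySpace (hR : 0 < R) (hθ : Real.cos θ ≠ 0)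
    (hz : logSolutionEndpoint R (Real.tan θ) z ≠ 0) (y : L2Interval R) :
    thetaResolvent R (Real.tan θ) z y ∈ boundarySpace R hR θ := by
  rw [thetaResolvent_apply]
  have h := (hasBoundaryData_volterraOp (volterraResolvent R z y) hR).add hR
    ((hasBoundaryData_logSolution hR (Real.tan θ) z).smul
      (endpointEval R (volterraResolvent R z y) * -(logSolutionEndpoint R (Real.tan θ) z)⁻¹))
  rw [mul_assoc _ _ (logSolutionEndpoint _ _ _), neg_mul, inv_mul_cancel₀ hz, mul_neg_one,
    add_neg_cancel, zero_add, zero_add, mul_one] at h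
  exact ⟨_, _, h, (cos_mul_add_sin_mul_eq_zero_iff hθ).2 rfl⟩

theorem isResolventAt_thetaResolvent (hR : 0 < R) (hθ : Real.cos θ ≠ 0)
    (hz : logSolutionEndpoint R (Real.tan θ) z ≠ 0) :
    IsResolventAt (deltaTheta R hR θ) z (thetaResolvent R (Real.tan θ) z) := by
  have hsurj : ∀ y : L2Interval R, ∃ x : (deltaTheta R hR θ).domain,
      (x : L2Interval R) = thetaResolvent R (Real.tan θ) z y ∧
        deltaTheta R hR θ x - z • (x : L2Interval R) = y := by
    intro y
    obtain ⟨x, hx, hx'⟩ := exists_deltaTheta_eq hR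
      (isWeakDelta_thetaResolvent hR.le (Real.tan θ) z y)
      (thetaResolvent_mem_boundarySpace hR hθ hz y)
    exact ⟨x, hx, by rw [hx', hx, add_sub_cancel_right]⟩
  refine ⟨fun x => ?_, hsurj⟩
  obtain ⟨x', hx, hx'⟩ := hsurj (deltaTheta R hR θ x - z • (x : L2Interval R))
  rw [← hx, ← sub_eq_zero]
  have hdiff := (isWeakDelta_deltaTheta hR x').sub (isWeakDelta_deltaTheta hR x)
  rw [sub_eq_sub_iff_sub_eq_sub.1 hx', ← smul_sub] at hdiff
  exact eq_zero_of_isWeakDelta_smul hR hθ hz hdiff ((boundarySpace R hR θ).sub_mem x'.2.1 x.2.1)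

theorem logSolution_mem_boundarySpace (hR : 0 < R) (hθ : Real.cos θ ≠ 0)
    (hz : logSolutionEndpoint R (Real.tan θ) z = 0) :
    logSolution R (Real.tan θ) z ∈ boundarySpace R hR θ :=
  ⟨_, _, hz ▸ hasBoundaryData_logSolution hR (Real.tan θ) z,
    (cos_mul_add_sin_mul_eq_zero_iff hθ).2 (one_mul _).symm⟩

theorem mem_unboundedResolventSet_deltaTheta_iff (hR : 0 < R) (hθ : Real.cos θ ≠ 0) :
    z ∈ unboundedResolventSet (deltaTheta R hR θ) ↔
      logSolutionEndpoint R (Real.tan θ) z ≠ 0 := by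
  refine ⟨?_, fun hz => ⟨_, isResolventAt_thetaResolvent hR hθ hz⟩⟩
  rintro ⟨S, hS⟩ hz
  obtain ⟨x, hx, hx'⟩ := exists_deltaTheta_eq hR (isWeakDelta_logSolution hR.le (Real.tan θ) z)
    (logSolution_mem_boundarySpace hR hθ hz)
  have hSx := hS.1 x
  rw [hx', hx, sub_self, map_zero] at hSx
  exact logSolution_ne_zero hR _ _ hSx.symm

theorem IsResolventAt.unique {H : Type} [NormedAddCommGroup H] [InnerProductSpace ℂ H]
    {A : H →ₗ.[ℂ] H} {S T : H →L[ℂ] H} (hS : IsResolventAt A z S)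
    (hT : IsResolventAt A z T) : S = T := by
  ext y
  obtain ⟨x, hx, hx'⟩ := hT.2 y
  rw [← hx, ← hS.1 x, hx']

theorem hasTrace_thetaResolvent (a : ℝ) (z : ℂ) :
    HasTrace (thetaResolvent R a z) (-logDeriv (logSolutionEndpoint R a) z) := by
  have h := (hasTrace_volterraOp_comp_volterraResolvent (R := R) z).add
    (hasTrace_smulRight (endpointEval R ∘L volterraResolvent R z)
      (-(logSolutionEndpoint R a z)⁻¹ • logSolution R a z))
  rw [zero_add, ContinuousLinearMap.comp_apply, map_smul, map_smul, smul_eq_mul] at h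
  rwa [logDeriv_apply, (hasDerivAt_logSolutionEndpoint a z).deriv, div_eq_inv_mul, ← neg_mul]

theorem IsResolventAt.hasTrace_deltaTheta (hR : 0 < R) (hθ : Real.cos θ ≠ 0)
    {S : L2Interval R →L[ℂ] L2Interval R} (hS : IsResolventAt (deltaTheta R hR θ) z S) :
    HasTrace S (-logDeriv (logSolutionEndpoint R (Real.tan θ)) z) := by
  have hz := (mem_unboundedResolventSet_deltaTheta_iff hR hθ).1 ⟨S, hS⟩
  rw [hS.unique (isResolventAt_thetaResolvent hR hθ hz)]
  exact hasTrace_thetaResolvent _ _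

end Resolvent

section CharacteristicFunction

variable {R θ : ℝ} {μ : ℂ}

theorem charF_eventuallyEq (hR : 0 < R) (θ : ℝ) (hμ : μ ≠ 0) :
    charF R θ =ᶠ[𝓝 μ] fun w =>
      2 / (Real.pi : ℂ) / √R * (logSolutionEndpoint R (Real.tan θ) ∘ (· ^ 2)) w := by
  filter_upwards [isOpen_ne.mem_nhds hμ] with w hw using charF_eq hR θ hw

theorem two_div_pi_div_sqrt_ne_zero (hR : 0 < R) : 2 / (Real.pi : ℂ) / √R ≠ 0 :=
  div_ne_zero (div_ne_zero two_ne_zero (mod_cast Real.pi_ne_zero)) (ofReal_sqrt_ne_zero hR)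

theorem charF_ne_zero_iff (hR : 0 < R) (θ : ℝ) (hμ : μ ≠ 0) :
    charF R θ μ ≠ 0 ↔ logSolutionEndpoint R (Real.tan θ) (μ ^ 2) ≠ 0 := by
  rw [charF_eq hR θ hμ, mul_ne_zero_iff_left (two_div_pi_div_sqrt_ne_zero hR)]

theorem differentiableAt_charF (hR : 0 < R) (θ : ℝ) (hμ : μ ≠ 0) :
    DifferentiableAt ℂ (charF R θ) μ :=
  (((hasDerivAt_logSolutionEndpoint (Real.tan θ) (μ ^ 2)).differentiableAt.comp μ
    (differentiableAt_id.pow 2)).const_mul _).congr_of_eventuallyEq (charF_eventuallyEq hR θ hμ)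

theorem logDeriv_charF (hR : 0 < R) (θ : ℝ) (hμ : μ ≠ 0) :
    logDeriv (charF R θ) μ =
      logDeriv (logSolutionEndpoint R (Real.tan θ)) (μ ^ 2) * (2 * μ) := by
  have hcharF := charF_eventuallyEq hR θ hμ
  rw [logDeriv_apply, hcharF.deriv_eq, hcharF.self_of_nhds, ← logDeriv_apply,
    logDeriv_const_mul μ _ (two_div_pi_div_sqrt_ne_zero hR), logDeriv_comp
      (hasDerivAt_logSolutionEndpoint _ _).differentiableAt (differentiableAt_id.pow 2)]
  simp

theorem exists_continuousAt_exp_eq {F : ℂ → ℂ} (hF : ∀ᶠ w in 𝓝 μ, ContinuousAt F w)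
    (h0 : F μ ≠ 0) : ∃ L : ℂ → ℂ, ∀ᶠ w in 𝓝 μ, ContinuousAt L w ∧ Complex.exp (L w) = F w := by
  refine ⟨fun w => Complex.log (F w / F μ) + Complex.log (F μ), ?_⟩
  have hquot : Tendsto (fun w => F w / F μ) (𝓝 μ) (𝓝 1) := by
    simpa [h0] using hF.self_of_nhds.tendsto.div_const (F μ)
  filter_upwards [hF, hquot.eventually
    (Complex.isOpen_slitPlane.mem_nhds Complex.one_mem_slitPlane)] with w hw hslit
  refine ⟨((hw.div_const _).clog hslit).add continuousAt_const, ?_⟩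
  rw [Complex.exp_add, Complex.exp_log (Complex.slitPlane_ne_zero hslit), Complex.exp_log h0,
    div_mul_cancel₀ _ h0]

theorem hasDerivAt_of_exp_eventuallyEq {F L : ℂ → ℂ} (hF : DifferentiableAt ℂ F μ)
    (hL : ContinuousAt L μ) (hexp : Complex.exp ∘ L =ᶠ[𝓝 μ] F) :
    HasDerivAt L (logDeriv F μ) μ := by
  rw [logDeriv_apply, ← hexp.self_of_nhds]
  exact .of_comp_left hL (Complex.hasDerivAt_exp _) hF.hasDerivAt (Complex.exp_ne_zero _) hexp

end CharacteristicFunction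

theorem theoremA1_general (R : ℝ) (hR : 0 < R) (θ : ℝ) (hθ : Real.cos θ ≠ 0) (μ : ℂ)
    (hμ : μ ≠ 0) :
    (μ ^ 2 ∈ unboundedResolventSet (deltaTheta R hR θ) ↔ charF R θ μ ≠ 0) ∧
    ∀ S : L2Interval R →L[ℂ] L2Interval R, IsResolventAt (deltaTheta R hR θ) (μ ^ 2) S →
      DifferentiableAt ℂ (charF R θ) μ ∧
      HasTrace S (-(1 / (2 * μ)) * (1 / charF R θ μ) * deriv (charF R θ) μ) ∧
      (∃ logF : ℂ → ℂ, ∀ᶠ z in 𝓝 μ,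
        ContinuousAt logF z ∧ Complex.exp (logF z) = charF R θ z) ∧
      ∀ logF : ℂ → ℂ,
        (∀ᶠ z in 𝓝 μ, ContinuousAt logF z ∧ Complex.exp (logF z) = charF R θ z) →
        DifferentiableAt ℂ logF μ ∧ HasTrace S (-(1 / (2 * μ)) * deriv logF μ) := by
  have hset : μ ^ 2 ∈ unboundedResolventSet (deltaTheta R hR θ) ↔ charF R θ μ ≠ 0 := by
    rw [mem_unboundedResolventSet_deltaTheta_iff hR hθ, charF_ne_zero_iff hR θ hμ]
  refine ⟨hset, fun S hS => ?_⟩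
  have hdiff := differentiableAt_charF hR θ hμ
  have htrace : HasTrace S (-(1 / (2 * μ)) * logDeriv (charF R θ) μ) := by
    convert hS.hasTrace_deltaTheta hR hθ using 1
    rw [logDeriv_charF hR θ hμ]
    field_simp
  have hcont : ∀ᶠ w in 𝓝 μ, ContinuousAt (charF R θ) w := by
    filter_upwards [isOpen_ne.mem_nhds hμ] with w hw using
      (differentiableAt_charF hR θ hw).continuousAt
  refine ⟨hdiff, ?_, exists_continuousAt_exp_eq hcont (hset.1 ⟨S, hS⟩), fun logF hlogF => ?_⟩
  · rwa [mul_assoc, one_div_mul_eq_div, ← logDeriv_apply]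
  · have hlog := hasDerivAt_of_exp_eventuallyEq hdiff hlogF.self_of_nhds.1
      (hlogF.mono fun _ h => h.2)
    exact ⟨hlog.differentiableAt, by rwa [hlog.deriv]⟩

theorem cos_ne_zero_of_ne_pi_div_two {θ : ℝ} (h₀ : 0 ≤ θ) (hpi : θ < Real.pi)
    (hθ : θ ≠ Real.pi / 2) : Real.cos θ ≠ 0 := fun h =>
  hθ <| Real.injOn_cos ⟨h₀, hpi.le⟩ ⟨Real.pi_div_two_pos.le, by linarith [Real.pi_pos]⟩
    (h.trans Real.cos_pi_div_two.symm)

theorem theoremA1 (R : ℝ) (hR : 0 < R) (θ : ℝ) (hθ₀ : 0 ≤ θ) (hθ₁ : θ < Real.pi)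
    (hθ : θ ≠ Real.pi / 2) (μ : ℂ) (hμ : μ ≠ 0) :
    (μ ^ 2 ∈ unboundedResolventSet (deltaTheta R hR θ) ↔ charF R θ μ ≠ 0) ∧
    ∀ S : L2Interval R →L[ℂ] L2Interval R, IsResolventAt (deltaTheta R hR θ) (μ ^ 2) S →
      DifferentiableAt ℂ (charF R θ) μ ∧
      HasTrace S (-(1 / (2 * μ)) * (1 / charF R θ μ) * deriv (charF R θ) μ) ∧
      (∃ logF : ℂ → ℂ, ∀ᶠ z in 𝓝 μ,
        ContinuousAt logF z ∧ Complex.exp (logF z) = charF R θ z) ∧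
      ∀ logF : ℂ → ℂ,
        (∀ᶠ z in 𝓝 μ, ContinuousAt logF z ∧ Complex.exp (logF z) = charF R θ z) →
        DifferentiableAt ℂ logF μ ∧ HasTrace S (-(1 / (2 * μ)) * deriv logF μ) :=
  theoremA1_general R hR θ (cos_ne_zero_of_ne_pi_div_two hθ₀ hθ₁ hθ) μ hμ
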